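/- Let $K>0$ and $k_B>0$ be constants, let $\nu$ be a Borel probability measure on $(0,K]$, and let $\hat\nu=\nu^{\mathbb Z}$ be the product measure on $\hat\Omega=(0,K]^{\mathbb Z}$. For $J\in\hat\Omega$, $\tau>0$ and natural numbers $l,r$, consider the Ising model on $\Lambda=[-l,r]\cap\mathbb Z$ with periodic boundary conditions ($\sigma_{r+1}:=\sigma_{-l}$): for $\sigma\in\{\pm1\}^{\Lambda}$ and a complex magnetic field $H$, $$E(\sigma)=-\frac1{k_B\tau}\sum_{j=-l}^{r}\bigl(J_j\sigma_j\sigma_{j+1}+H\sigma_j\bigr),\qquad Z_\tau=\sum_{\sigma\in\{\pm1\}^{\Lambda}}e^{-E(\sigma)}.$$ Its Lee–Yang zeros are the zeros of $Z_\tau$ in the variable $h=e^{2H/(k_B\tau)}$, that is, the set $$\mathcal Z_\tau^{J}(l,r)=\{\,e^{2H/(k_B\tau)} : H\in\mathbb C,\ Z_\tau(H)=0\,\}\subset\mathbb C .$$ For $\alpha=(\alpha_n)_{n\in\mathbb Z}$ in the open unit disk and $\rho_n=(1-|\alpha_n|^2)^{1/2}$, the extended CMV matrix with coefficients $\alpha$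 is the operator $\mathcal E$ on $\ell^2(\mathbb Z)$ whose rows $2j$ and $2j+1$, $j\in\mathbb Z$, have in the columns $2j-1,\,2j,\,2j+1,\,2j+2$ the entries $$\begin{pmatrix}\bar\alpha_{2j}\rho_{2j-1}&-\bar\alpha_{2j}\alpha_{2j-1}&\bar\alpha_{2j+1}\rho_{2j}&\rho_{2j+1}\rho_{2j}\\ \rho_{2j}\rho_{2j-1}&-\rho_{2j}\alpha_{2j-1}&-\bar\alpha_{2j+1}\alpha_{2j}&-\rho_{2j+1}\alpha_{2j}\end{pmatrix}$$ and zeros elsewhere. Then for $\hat\nu$-almost every $J\in\hat\Omega$ the following holds for every $\tau>0$. Let $\mathcal E_\omega$ be the extended CMV matrix with coefficients $\omega_n=e^{-2J_n/(k_B\tau)}$, $n\in\mathbb Z$. The spectrum $\sigma(\mathcal E_\omega)$ and the sets $\mathcal Z_\tau^{J}(l,r)$, for all natural numbers $l,r$, are contained in the unit circle $\partial\mathbb D$, and for any sequences $(N^l_k)$, $(N^r_k)$ of natural numbers that tend to infinity as $k\to\infty$, $$\lim_{k\to\infty}\mathrm{dist}_H\bigl(\mathcal Z_\tau^{J}(N^l_k,N^r_k),\,\sigma(\mathcal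 E_\omega)\bigr)=0,$$ where $\mathrm{dist}_H$ is the Hausdorff distance. -/

import Mathlib

open MeasureTheory Filter Topology
open scoped ENNReal ComplexConjugate Complex.UnitDisc

noncomputable section

/-! ### Extended CMV matrices -/

/-- The Hilbert space `ℓ²(ℤ)`. -/
abbrev EllTwoZ : Type := lp (fun _ : ℤ => ℂ) 2

/-- `ρ = (1 - |α|²)^{1/2}`. -/
def verblunskyRho (a : 𝔻) : ℝ := Real.sqrt (1 - ‖(a : ℂ)‖ ^ 2)

/-- The entry in row `n` and column `m` of the extended CMV matrix with Verblunsky coefficients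
`α : ℤ → 𝔻`. The rows `2j` and `2j + 1` are
`ᾱ_{2j} ρ_{2j-1}, -ᾱ_{2j} α_{2j-1}, ᾱ_{2j+1} ρ_{2j}, ρ_{2j+1} ρ_{2j}` and
`ρ_{2j} ρ_{2j-1}, -ρ_{2j} α_{2j-1}, -ᾱ_{2j+1} α_{2j}, -ρ_{2j+1} α_{2j}`,
both placed in the columns `2j-1, 2j, 2j+1, 2j+2`; all other entries vanish. -/
def extendedCMVEntry (α : ℤ → 𝔻) (n m : ℤ) : ℂ :=
  if Even n then
    if m = n - 1 then conj (α n : ℂ) * verblunskyRho (α (n - 1))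
    else if m = n then -(conj (α n : ℂ) * (α (n - 1) : ℂ))
    else if m = n + 1 then conj (α (n + 1) : ℂ) * verblunskyRho (α n)
    else if m = n + 2 then (verblunskyRho (α (n + 1)) : ℂ) * verblunskyRho (α n)
    else 0
  else
    if m = n - 2 then (verblunskyRho (α (n - 1)) : ℂ) * verblunskyRho (α (n - 2))
    else if m = n - 1 then -((verblunskyRho (α (n - 1)) : ℂ) * (α (n - 2) : ℂ))
    else if m = n then -(conj (α n : ℂ) * (α (n - 1) : ℂ))
    else if m = n + 1 then -((verblunskyRho (α n) : ℂ) * (α (n - 1) : ℂ))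
    else 0

theorem norm_verblunskyRho_le (a : 𝔻) : ‖(verblunskyRho a : ℂ)‖ ≤ 1 := by
  rw [Complex.norm_real, Real.norm_eq_abs, verblunskyRho, abs_of_nonneg (Real.sqrt_nonneg _)]
  exact Real.sqrt_le_one.2 (by nlinarith [sq_nonneg ‖(a : ℂ)‖])

theorem norm_extendedCMVEntry_le (α : ℤ → 𝔻) (n m : ℤ) : ‖extendedCMVEntry α n m‖ ≤ 1 := by
  have h1 : ∀ a : 𝔻, ‖(a : ℂ)‖ ≤ 1 := fun a => a.norm_lt_one.le
  have h2 := norm_verblunskyRho_le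
  have key : ∀ x y : ℂ, ‖x‖ ≤ 1 → ‖y‖ ≤ 1 → ‖x * y‖ ≤ 1 := fun x y hx hy => by
    rw [norm_mul]; exact mul_le_one₀ hx (norm_nonneg _) hy
  unfold extendedCMVEntry
  split_ifs <;> (try rw [norm_neg]) <;> (try simp only [norm_zero, zero_le_one]) <;>
    (apply key <;> (try rw [RCLike.norm_conj]) <;> first | exact h1 _ | exact h2 _)

theorem weightedShift_summable {d : ℤ → ℂ} (hd : ∀ n, ‖d n‖ ≤ 1) (k : ℤ) (ψ : EllTwoZ) :
    (Summable fun n : ℤ => ‖d n * ψ (n + k)‖ ^ (2 : ℝ≥0∞).toReal) ∧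
      ∑' n : ℤ, ‖d n * ψ (n + k)‖ ^ (2 : ℝ≥0∞).toReal ≤ ‖ψ‖ ^ (2 : ℝ≥0∞).toReal := by
  have hp : 0 < (2 : ℝ≥0∞).toReal := by norm_num
  have hs : HasSum (fun n : ℤ => ‖ψ (n + k)‖ ^ (2 : ℝ≥0∞).toReal)
      (‖ψ‖ ^ (2 : ℝ≥0∞).toReal) :=
    (Equiv.addRight k).hasSum_iff.2 (lp.hasSum_norm hp ψ)
  have hle : ∀ n : ℤ, ‖d n * ψ (n + k)‖ ^ (2 : ℝ≥0∞).toReal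
      ≤ ‖ψ (n + k)‖ ^ (2 : ℝ≥0∞).toReal := fun n => by
    refine Real.rpow_le_rpow (norm_nonneg _) ?_ hp.le
    rw [norm_mul]
    exact mul_le_of_le_one_left (norm_nonneg _) (hd n)
  have hsum : Summable fun n : ℤ => ‖d n * ψ (n + k)‖ ^ (2 : ℝ≥0∞).toReal :=
    Summable.of_nonneg_of_le (fun n => Real.rpow_nonneg (norm_nonneg _) _) hle hs.summable
  exact ⟨hsum, hs.tsum_eq ▸ hsum.tsum_le_tsum hle hs.summable⟩

/-- The operator `(W ψ)(n) = d(n) ψ(n + k)` on `ℓ²(ℤ)`, for a sequence `d` bounded by `1`. -/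
def weightedShift (d : ℤ → ℂ) (hd : ∀ n, ‖d n‖ ≤ 1) (k : ℤ) : EllTwoZ →L[ℂ] EllTwoZ :=
  LinearMap.mkContinuous
    { toFun := fun ψ => ⟨fun n => d n * ψ (n + k), memℓp_gen (weightedShift_summable hd k ψ).1⟩
      map_add' := fun ψ φ => by
        ext n
        exact mul_add (d n) (ψ (n + k)) (φ (n + k))
      map_smul' := fun c ψ => by
        ext n
        exact mul_left_comm (d n) c (ψ (n + k)) }
    1 (fun ψ => by
      rw [one_mul]
      exact lp.norm_le_of_tsum_le (by norm_num) (norm_nonneg _)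
        (weightedShift_summable hd k ψ).2)

/-- The extended CMV matrix with Verblunsky coefficients `α`, as a bounded operator on `ℓ²(ℤ)`:
the sum over its diagonals `k = -2, …, 2`. -/
def extendedCMV (α : ℤ → 𝔻) : EllTwoZ →L[ℂ] EllTwoZ :=
  ∑ k ∈ Finset.Icc (-2 : ℤ) 2,
    weightedShift (fun n => extendedCMVEntry α n (n + k))
      (fun n => norm_extendedCMVEntry_le α n (n + k)) k

theorem extendedCMV_apply (α : ℤ → 𝔻) (ψ : EllTwoZ) (n : ℤ) :
    extendedCMV α ψ n =
      ∑ k ∈ Finset.Icc (-2 : ℤ) 2, extendedCMVEntry α n (n + k) * ψ (n + k) := by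
  have h : ∀ (s : Finset ℤ) (W : ℤ → EllTwoZ →L[ℂ] EllTwoZ),
      (∑ k ∈ s, W k) ψ n = ∑ k ∈ s, (W k ψ) n := fun s W => by
    rw [_root_.sum_apply, lp.coeFn_sum, Finset.sum_apply]
  exact h _ _

/-! ### The Ising model on the lattice `[-l, r] ∩ ℤ` with periodic boundary conditions -/

/-- The sites of the lattice `[-l, r] ∩ ℤ`. -/
abbrev IsingSite (l r : ℕ) : Type := ↥(Finset.Icc (-(l : ℤ)) (r : ℤ))

/-- The right neighbour of a site: `j + 1`, except that the right neighbour of `r` is `-l`. -/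
def IsingSite.next {l r : ℕ} (j : IsingSite l r) : IsingSite l r :=
  if h : (j : ℤ) + 1 ≤ r then
    ⟨(j : ℤ) + 1, Finset.mem_Icc.2 ⟨by have := (Finset.mem_Icc.1 j.2).1; omega, h⟩⟩
  else ⟨-(l : ℤ), Finset.mem_Icc.2 ⟨le_rfl, by omega⟩⟩

/-- Spin configurations `σ ∈ {1, -1}^{[-l, r] ∩ ℤ}`; the units of `ℤ` are exactly `1` and `-1`. -/
abbrev IsingConfig (l r : ℕ) : Type := IsingSite l r → ℤˣ

/-- The energy `E(σ) = -(1 / (k_B τ)) ∑_j (J_j σ_j σ_{j+1} + H σ_j)`, with complex field `H`. -/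
def isingEnergy (J : ℤ → ℝ) (kB τ : ℝ) (l r : ℕ) (H : ℂ) (σ : IsingConfig l r) : ℂ :=
  -(1 / ((kB : ℂ) * (τ : ℂ))) *
    ∑ j : IsingSite l r,
      ((J j : ℂ) * ((σ j : ℤ) : ℂ) * ((σ j.next : ℤ) : ℂ) + H * ((σ j : ℤ) : ℂ))

/-- The partition function, as a function of the complex field `H`. -/
def partitionFunction (J : ℤ → ℝ) (kB τ : ℝ) (l r : ℕ) (H : ℂ) : ℂ :=
  ∑ σ : IsingConfig l r, Complex.exp (-isingEnergy J kB τ l r H σ)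

/-- The Lee–Yang zeros: the zeros of the partition function in the variable
`h = exp (2 H / (k_B τ))`. (Replacing `H` by another field with the same `h` can only change
the sign of the partition function.) -/
def leeYangZeros (J : ℤ → ℝ) (kB τ : ℝ) (l r : ℕ) : Set ℂ :=
  {h | ∃ H : ℂ, h = Complex.exp (2 * H / ((kB : ℂ) * (τ : ℂ))) ∧
    partitionFunction J kB τ l r H = 0}

/-- The Verblunsky coefficient `exp (-2 x / (k_B τ)) ∈ (0, 1)` that belongs to the coupling
`x ∈ (0, K]`. -/
def isingVerblunsky {K kB τ : ℝ} (hkB : 0 < kB) (hτ : 0 < τ) (x : Set.Ioc (0 : ℝ) K) : 𝔻 :=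
  Complex.UnitDisc.mk ((Real.exp (-2 * (x : ℝ) / (kB * τ)) : ℝ) : ℂ) (by
    rw [Complex.norm_real, Real.norm_eq_abs, Real.abs_exp, Real.exp_lt_one_iff]
    exact div_neg_of_neg_of_pos (by linarith [x.2.1]) (mul_pos hkB hτ))

end

/-! Put `p = l + r + 1` and continue the couplings on `[-l, r]` with period `p`. Up to a
nonvanishing factor, the partition function is the trace of a product `P` of 2 × 2 transfer matrices
of determinant one, in the variable `w` with `w ^ 2 = h`. By Cayley–Hamilton `P * P = P.trace • P -
1`, so the trace vanishes exactly when some nonzero vector changes sign under `P * P`. The same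
matrices propagate the solutions of `cmvAct a ρ u = w ^ 2 • u`. Hence the Lee–Yang zeros are the
eigenvalues of the periodized CMV operator on `2 * p`-antiperiodic sequences
(`exists_antiperiodic_of_trace_eq_zero`, `trace_eq_zero_of_antiperiodic`). Doubling `p` also makes
the period even, which CMV matrices need because even and odd rows differ.

Almost surely every zero lies in the spectrum (`leeYangZeros_subset_spectrum`). By Borel–Cantelli,
`J` contains arbitrarily long and accurate copies of its own periodized words at even positions. Off
the spectrum `E - z` is bounded below, and this bound survives limits of even shifts, so it would
hold for the periodized operator, where truncations of a bounded eigenvector violate it.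

Conversely, for every `J` each spectral point is a limit of zeros (`exists_mem_leeYangZeros_near`).
It has a finitely supported approximate eigenvector, which fits into the window once `l` and `r` are
large. Since the operator on antiperiodic sequences is unitary, it has an eigenvalue nearby.
Compactness of the spectrum turns these two facts into Hausdorff convergence. -/

noncomputable section

/-! ### Factorization of a real CMV matrix into two families of reflections -/

/-- The direct sum of the reflections `!![a n, ρ n; ρ n, -a n]` in the coordinates `n, n + 1`,
over all `n` for which `n + e` is even. -/
def scatter (e : ℤ) (a ρ : ℤ → ℝ) : (ℤ → ℂ) →ₗ[ℂ] (ℤ → ℂ) where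
  toFun ψ n := if Even (n + e) then (a n : ℂ) * ψ n + ρ n * ψ (n + 1)
    else (ρ (n - 1) : ℂ) * ψ (n - 1) - a (n - 1) * ψ n
  map_add' ψ φ := by
    ext n
    simp only [Pi.add_apply]
    split_ifs <;> ring
  map_smul' c ψ := by
    ext n
    simp only [Pi.smul_apply, smul_eq_mul, RingHom.id_apply]
    split_ifs <;> ring

theorem scatter_of_even {e n : ℤ} (h : Even (n + e)) (a ρ : ℤ → ℝ) (ψ : ℤ → ℂ) :
    scatter e a ρ ψ n = (a n : ℂ) * ψ n + ρ n * ψ (n + 1) := if_pos h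

theorem scatter_of_not_even {e n : ℤ} (h : ¬ Even (n + e)) (a ρ : ℤ → ℝ) (ψ : ℤ → ℂ) :
    scatter e a ρ ψ n = (ρ (n - 1) : ℂ) * ψ (n - 1) - a (n - 1) * ψ n := if_neg h

theorem scatter_succ_of_even {e n : ℤ} (h : Even (n + e)) (a ρ : ℤ → ℝ) (ψ : ℤ → ℂ) :
    scatter e a ρ ψ (n + 1) = (ρ n : ℂ) * ψ n - a n * ψ (n + 1) := by
  rw [scatter_of_not_even (by grind), add_sub_cancel_right]

theorem scatter_pred_of_not_even {e n : ℤ} (h : ¬ Even (n + e)) (a ρ : ℤ → ℝ) (ψ : ℤ → ℂ) :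
    scatter e a ρ ψ (n - 1) = (a (n - 1) : ℂ) * ψ (n - 1) + ρ (n - 1) * ψ n := by
  rw [scatter_of_even (by grind), sub_add_cancel]

theorem scatter_scatter {a ρ : ℤ → ℝ} (h : ∀ n, a n ^ 2 + ρ n ^ 2 = 1) (e : ℤ) (ψ : ℤ → ℂ) :
    scatter e a ρ (scatter e a ρ ψ) = ψ := by
  have h' : ∀ n, (a n : ℂ) ^ 2 + (ρ n : ℂ) ^ 2 = 1 := fun n => by exact_mod_cast h n
  ext n
  by_cases hn : Even (n + e)
  · rw [scatter_of_even hn, scatter_of_even hn, scatter_succ_of_even hn]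
    linear_combination ψ n * h' n
  · rw [scatter_of_not_even hn, scatter_of_not_even hn, scatter_pred_of_not_even hn]
    linear_combination ψ n * h' (n - 1)

/-- The flux whose increments are the local changes of `‖ψ n‖ ^ 2` under `scatter`. -/
def scatterFlux (e : ℤ) (a ρ : ℤ → ℝ) (ψ : ℤ → ℂ) (n : ℤ) : ℝ :=
  if Even (n + e) then 0
  else ‖(a (n - 1) : ℂ) * ψ (n - 1) + ρ (n - 1) * ψ n‖ ^ 2 - ‖ψ (n - 1)‖ ^ 2

theorem norm_sq_reflect {a ρ : ℝ} (h : a ^ 2 + ρ ^ 2 = 1) (x y : ℂ) :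
    ‖(a : ℂ) * x + ρ * y‖ ^ 2 + ‖(ρ : ℂ) * x - a * y‖ ^ 2 = ‖x‖ ^ 2 + ‖y‖ ^ 2 := by
  simp only [← Complex.normSq_eq_norm_sq, Complex.normSq_apply, Complex.add_re, Complex.add_im,
    Complex.sub_re, Complex.sub_im, Complex.mul_re, Complex.mul_im, Complex.ofReal_re,
    Complex.ofReal_im]
  linear_combination (x.re ^ 2 + x.im ^ 2 + y.re ^ 2 + y.im ^ 2) * h

theorem norm_sq_scatter {a ρ : ℤ → ℝ} (h : ∀ n, a n ^ 2 + ρ n ^ 2 = 1) (e : ℤ) (ψ : ℤ → ℂ)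
    (n : ℤ) : ‖scatter e a ρ ψ n‖ ^ 2 =
      ‖ψ n‖ ^ 2 + (scatterFlux e a ρ ψ (n + 1) - scatterFlux e a ρ ψ n) := by
  by_cases hn : Even (n + e)
  · have hn' : ¬ Even (n + 1 + e) := by grind
    rw [scatter_of_even hn, scatterFlux, scatterFlux, if_neg hn', if_pos hn, add_sub_cancel_right]
    ring
  · have hn' : Even (n + 1 + e) := by grind
    rw [scatter_of_not_even hn, scatterFlux, scatterFlux, if_neg hn, if_pos hn']
    linear_combination norm_sq_reflect (h (n - 1)) (ψ (n - 1)) (ψ n)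

theorem abs_scatterFlux_le {a ρ : ℤ → ℝ} (h : ∀ n, a n ^ 2 + ρ n ^ 2 = 1) (e : ℤ) (ψ : ℤ → ℂ)
    (n : ℤ) : |scatterFlux e a ρ ψ n| ≤ ‖ψ (n - 1)‖ ^ 2 + ‖ψ n‖ ^ 2 := by
  rw [scatterFlux]
  split_ifs
  · rw [abs_zero]
    positivity
  · refine abs_sub_le_of_nonneg_of_le (by positivity) ?_ (by positivity) ?_
    · rw [← norm_sq_reflect (h (n - 1)) (ψ (n - 1)) (ψ n)]
      exact le_add_of_nonneg_right (by positivity)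
    · exact le_add_of_nonneg_right (by positivity)

/-- The norm density changes by increments of the flux. The flux is summable, so it has the same sum
as its shift and the increments cancel. -/
theorem hasSum_norm_sq_scatter {a ρ : ℤ → ℝ} (h : ∀ n, a n ^ 2 + ρ n ^ 2 = 1) (e : ℤ)
    {ψ : ℤ → ℂ} {S : ℝ} (hψ : HasSum (fun n => ‖ψ n‖ ^ 2) S) :
    HasSum (fun n => ‖scatter e a ρ ψ n‖ ^ 2) S := by
  have hpred : Summable fun n : ℤ => ‖ψ (n - 1)‖ ^ 2 :=
    (Equiv.subRight (1 : ℤ)).summable_iff.2 hψ.summable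
  have hF : Summable (scatterFlux e a ρ ψ) :=
    Summable.of_norm_bounded (hpred.add hψ.summable) (abs_scatterFlux_le h e ψ)
  have hshift : ∀ {F : ℤ → ℝ}, Summable F → HasSum (fun n => F (n + 1)) (∑' n, F n) :=
    fun hF => (Equiv.addRight (1 : ℤ)).hasSum_iff.2 hF.hasSum
  simp only [norm_sq_scatter h]
  convert hψ.add ((hshift hF).sub hF.hasSum) using 1
  ring

theorem antiperiodic_scatter {a ρ : ℤ → ℝ} {N : ℤ} (hN : Even N) (ha : Function.Periodic a N)
    (hρ : Function.Periodic ρ N) (e : ℤ) {ψ : ℤ → ℂ} (hψ : Function.Antiperiodic ψ N) :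
    Function.Antiperiodic (scatter e a ρ ψ) N := by
  intro n
  have hψ1 : ψ (n + N + 1) = -ψ (n + 1) := by rw [add_right_comm, hψ]
  have hψ2 : ψ (n + N - 1) = -ψ (n - 1) := by rw [add_sub_right_comm, hψ]
  by_cases hn : Even (n + e)
  · rw [scatter_of_even hn, scatter_of_even (by grind), hψ1, hψ, ha, hρ]
    ring
  · rw [scatter_of_not_even hn, scatter_of_not_even (by grind), hψ2, hψ, add_sub_right_comm,
      ha, hρ]
    ring

theorem sum_Ico_sub_of_periodic {F : ℤ → ℝ} {N : ℕ} (hF : Function.Periodic F (N : ℤ)) (b : ℤ) :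
    ∑ n ∈ Finset.Ico b (b + N), (F (n + 1) - F n) = 0 := by
  have h : ∀ k : ℕ, ∑ n ∈ Finset.Ico b (b + k), (F (n + 1) - F n) = F (b + k) - F b := by
    intro k
    induction k with
    | zero => simp
    | succ k ih =>
      have : Finset.Ico b (b + (k + 1 : ℕ)) = insert (b + k) (Finset.Ico b (b + k)) := by
        ext m
        simp only [Finset.mem_Ico, Finset.mem_insert]
        push_cast
        omega
      rw [this, Finset.sum_insert (by simp), ih]
      push_cast
      rw [add_assoc]
      ring
  rw [h, hF, sub_self]

theorem sum_norm_sq_scatter {a ρ : ℤ → ℝ} (h : ∀ n, a n ^ 2 + ρ n ^ 2 = 1) {N : ℕ} (hN : Even N)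
    (ha : Function.Periodic a (N : ℤ)) (hρ : Function.Periodic ρ (N : ℤ)) (e b : ℤ) {ψ : ℤ → ℂ}
    (hψ : Function.Antiperiodic ψ (N : ℤ)) :
    ∑ n ∈ Finset.Ico b (b + N), ‖scatter e a ρ ψ n‖ ^ 2 =
      ∑ n ∈ Finset.Ico b (b + N), ‖ψ n‖ ^ 2 := by
  have hF : Function.Periodic (scatterFlux e a ρ ψ) (N : ℤ) := by
    intro n
    have hN' : Even (N : ℤ) := by exact_mod_cast hN
    have hiff : Even (n + N + e) ↔ Even (n + e) := by grind
    rw [scatterFlux, scatterFlux]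
    simp only [hiff]
    rw [add_sub_right_comm, ha, hρ, hψ, hψ, mul_neg, mul_neg, ← neg_add, norm_neg, norm_neg]
  simp only [norm_sq_scatter h, Finset.sum_add_distrib, sum_Ico_sub_of_periodic hF, add_zero]

theorem scatter_shift (e : ℤ) (a ρ : ℤ → ℝ) (ψ : ℤ → ℂ) {s : ℤ} (hs : Even s) :
    scatter e (fun n => a (n + s)) (fun n => ρ (n + s)) (fun n => ψ (n + s)) =
      fun n => scatter e a ρ ψ (n + s) := by
  ext n
  by_cases hn : Even (n + e)
  · rw [scatter_of_even hn, scatter_of_even (by grind), add_right_comm]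
  · rw [scatter_of_not_even hn, scatter_of_not_even (by grind), sub_add_eq_add_sub]

/-- The extended CMV matrix with real Verblunsky coefficients `a`, acting on all sequences. -/
def cmvAct (a ρ : ℤ → ℝ) : (ℤ → ℂ) →ₗ[ℂ] (ℤ → ℂ) := scatter 0 a ρ ∘ₗ scatter 1 a ρ

theorem cmvAct_apply (a ρ : ℤ → ℝ) (ψ : ℤ → ℂ) :
    cmvAct a ρ ψ = scatter 0 a ρ (scatter 1 a ρ ψ) := rfl

theorem cmvAct_of_even {n : ℤ} (hn : Even n) (a ρ : ℤ → ℝ) (ψ : ℤ → ℂ) :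
    cmvAct a ρ ψ n = a n * (ρ (n - 1) * ψ (n - 1) - a (n - 1) * ψ n) +
      ρ n * (a (n + 1) * ψ (n + 1) + ρ (n + 1) * ψ (n + 2)) := by
  rw [cmvAct_apply, scatter_of_even (by simpa using hn), scatter_of_not_even (by grind),
    scatter_of_even (by grind), add_assoc n 1 1]
  rfl

theorem cmvAct_of_not_even {n : ℤ} (hn : ¬ Even n) (a ρ : ℤ → ℝ) (ψ : ℤ → ℂ) :
    cmvAct a ρ ψ n = ρ (n - 1) * (ρ (n - 2) * ψ (n - 2) - a (n - 2) * ψ (n - 1)) -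
      a (n - 1) * (a n * ψ n + ρ n * ψ (n + 1)) := by
  rw [cmvAct_apply, scatter_of_not_even (by simpa using hn), scatter_of_not_even (by grind),
    scatter_of_even (by grind), sub_sub n 1 1]
  rfl

theorem cmvAct_shift (a ρ : ℤ → ℝ) (ψ : ℤ → ℂ) {s : ℤ} (hs : Even s) :
    cmvAct (fun n => a (n + s)) (fun n => ρ (n + s)) (fun n => ψ (n + s)) =
      fun n => cmvAct a ρ ψ (n + s) := by
  rw [cmvAct_apply, scatter_shift 1 a ρ ψ hs, scatter_shift 0 a ρ _ hs]
  rfl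

/-- For real coefficients, multiplying out the two families of reflections reproduces the five
diagonals. This gives unitarity and a first-order form of the eigenvalue equation. -/
theorem extendedCMV_apply_eq_cmvAct {α : ℤ → 𝔻} {a : ℤ → ℝ} (ha : ∀ n, (α n : ℂ) = a n)
    (ψ : EllTwoZ) (n : ℤ) :
    extendedCMV α ψ n = cmvAct a (fun n => verblunskyRho (α n)) ψ n := by
  have hIcc : Finset.Icc (-2 : ℤ) 2 = {-2, -1, 0, 1, 2} := by decide
  rw [extendedCMV_apply, hIcc]
  by_cases hn : Even n
  · rw [cmvAct_of_even hn]
    simp [extendedCMVEntry, hn, ha, sub_eq_add_neg]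
    ring
  · rw [cmvAct_of_not_even hn]
    simp [extendedCMVEntry, hn, ha, sub_eq_add_neg]
    ring

attribute [irreducible] scatter cmvAct

/-! ### Approximate eigenvectors of normal operators -/

section HilbertSpace

variable {E : Type*} [NormedAddCommGroup E] [InnerProductSpace ℂ E] [CompleteSpace E]

theorem isStarNormal_sub_algebraMap {T : E →L[ℂ] E} [IsStarNormal T] (z : ℂ) :
    IsStarNormal (T - algebraMap ℂ (E →L[ℂ] E) z) := by
  have : IsStarNormal (algebraMap ℂ (E →L[ℂ] E) z) := ⟨Algebra.commute_algebraMap_right _ _⟩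
  refine Commute.isStarNormal_sub ?_
  rw [← algebraMap_star_comm]
  exact Algebra.commute_algebraMap_right _ _

/-- A lower bound makes the map injective with closed range. For a normal operator the orthogonal
complement of the range is the kernel, here zero, so the range is also dense. -/
theorem ContinuousLinearMap.isUnit_of_isStarNormal_of_le_norm {T : E →L[ℂ] E} (hT : IsStarNormal T)
    {ε : ℝ} (hε : 0 < ε) (h : ∀ x, ε * ‖x‖ ≤ ‖T x‖) : IsUnit T := by
  have hanti : AntilipschitzWith (Real.toNNReal ε⁻¹) T := by
    refine T.antilipschitz_of_bound fun x => ?_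
    rw [Real.coe_toNNReal _ (inv_nonneg.2 hε.le), ← div_eq_inv_mul, le_div_iff₀' hε]
    exact h x
  rw [ContinuousLinearMap.isUnit_iff_bijective,
    ContinuousLinearMap.bijective_iff_dense_range_and_antilipschitz]
  refine ⟨?_, _, hanti⟩
  rw [Submodule.topologicalClosure_eq_top_iff, ContinuousLinearMap.IsStarNormal.orthogonal_range hT]
  exact LinearMap.ker_eq_bot.2 hanti.injective

theorem ContinuousLinearMap.exists_norm_sub_lt_of_mem_spectrum {T : E →L[ℂ] E}
    (hT : IsStarNormal T) {z : ℂ} (hz : z ∈ spectrum ℂ T) {ε : ℝ} (hε : 0 < ε) :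
    ∃ x, ‖T x - z • x‖ < ε * ‖x‖ := by
  by_contra! hcon
  have hn := isStarNormal_sub_algebraMap (T := T) z
  rw [spectrum.mem_iff, IsUnit.sub_iff] at hz
  exact hz (isUnit_of_isStarNormal_of_le_norm hn hε fun x => by
    simpa [Algebra.algebraMap_eq_smul_one] using hcon x)

/-- The inverse of `T - z` is normal, so its norm equals `‖y‖` for some spectral value `y`. The
vector `x` forces this norm above `δ⁻¹`, and then `y⁻¹ + z` is a spectral value of `T` within `δ` of
`z`. -/
theorem ContinuousLinearMap.exists_mem_spectrum_of_norm_sub_lt {T : E →L[ℂ] E}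
    (hT : IsStarNormal T) {z : ℂ} {δ : ℝ} {x : E} (hx : ‖T x - z • x‖ < δ * ‖x‖) :
    ∃ y ∈ spectrum ℂ T, ‖y - z‖ < δ := by
  have hδx : 0 < δ * ‖x‖ := (norm_nonneg _).trans_lt hx
  have hδ : 0 < δ := pos_of_mul_pos_left hδx (norm_nonneg x)
  have hx0 : 0 < ‖x‖ := pos_of_mul_pos_right hδx hδ.le
  by_cases hz : z ∈ spectrum ℂ T
  · exact ⟨z, hz, by simpa using hδ⟩
  rw [spectrum.notMem_iff, IsUnit.sub_iff] at hz
  obtain ⟨u, hu⟩ := hz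
  have hn := isStarNormal_sub_algebraMap (T := T) z
  rw [← hu] at hn
  have : Nontrivial E := ⟨x, 0, norm_pos_iff.1 hx0⟩
  obtain ⟨y, hy, hyu⟩ := spectrum.exists_nnnorm_eq_spectralRadius (↑u⁻¹ : E →L[ℂ] E)
  rw [IsStarNormal.spectralRadius_eq_nnnorm, ENNReal.coe_inj] at hyu
  have hyu' : ‖y‖ = ‖(↑u⁻¹ : E →L[ℂ] E)‖ := congrArg NNReal.toReal hyu
  have hux : (u : E →L[ℂ] E) x = T x - z • x := by
    rw [hu]
    simp [Algebra.algebraMap_eq_smul_one]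
  have h1 : x = (↑u⁻¹ : E →L[ℂ] E) (T x - z • x) := by
    rw [← hux, ← mul_apply_eq_comp, u.inv_mul, one_apply_eq_self]
  have h2 : ‖x‖ < ‖y‖ * (δ * ‖x‖) := by
    have h3 : ‖x‖ ≤ ‖y‖ * ‖T x - z • x‖ := by
      rw [hyu']
      nth_rw 1 [h1]
      exact ContinuousLinearMap.le_opNorm _ _
    have hy0 : 0 < ‖y‖ := by
      by_contra! hy0
      nlinarith [norm_nonneg (T x - z • x)]
    exact h3.trans_lt (mul_lt_mul_of_pos_left hx hy0)
  have h4 : 1 < ‖y‖ * δ := by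
    rw [← mul_assoc] at h2
    exact (lt_mul_iff_one_lt_left hx0).1 h2
  have hy0 : 0 < ‖y‖ := pos_of_mul_pos_left (one_pos.trans h4) hδ.le
  refine ⟨y⁻¹ + z, ?_, ?_⟩
  · rw [← spectrum.map_inv, Set.mem_inv, hu, ← spectrum.sub_singleton_eq] at hy
    obtain ⟨v, hv, _, rfl, hvy⟩ := hy
    rwa [← hvy, sub_add_cancel]
  · rw [add_sub_cancel_right, norm_inv]
    exact inv_lt_of_inv_lt₀ hδ (by rwa [inv_lt_iff_one_lt_mul₀ hδ])

theorem LinearIsometryEquiv.mem_unitary (e : E ≃ₗᵢ[ℂ] E) :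
    (e : E →L[ℂ] E) ∈ unitary (E →L[ℂ] E) :=
  (Unitary.linearIsometryEquiv.symm e).2

end HilbertSpace

/-! ### The CMV operator on `ℓ²(ℤ)`: unitarity and finitely supported test vectors -/

theorem EllTwoZ.hasSum_norm_sq (ψ : EllTwoZ) : HasSum (fun n => ‖ψ n‖ ^ 2) (‖ψ‖ ^ 2) := by
  simpa using lp.hasSum_norm (p := 2) (by norm_num) ψ

/-- The operator `scatter` on `ℓ²(ℤ)`. -/
def scatterIsometry {a ρ : ℤ → ℝ} (h : ∀ n, a n ^ 2 + ρ n ^ 2 = 1) (e : ℤ) :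
    EllTwoZ ≃ₗᵢ[ℂ] EllTwoZ :=
  have hmem : ∀ ψ : EllTwoZ, Memℓp (scatter e a ρ ψ) 2 := fun ψ =>
    memℓp_gen (by simpa using (hasSum_norm_sq_scatter h e ψ.hasSum_norm_sq).summable)
  { toFun := fun ψ => ⟨scatter e a ρ ψ, hmem ψ⟩
    invFun := fun ψ => ⟨scatter e a ρ ψ, hmem ψ⟩
    map_add' := fun ψ φ => Subtype.ext ((scatter e a ρ).map_add ψ φ)
    map_smul' := fun c ψ => Subtype.ext ((scatter e a ρ).map_smul c ψ)
    left_inv := fun ψ => Subtype.ext (scatter_scatter h e ψ)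
    right_inv := fun ψ => Subtype.ext (scatter_scatter h e ψ)
    norm_map' := fun ψ => by
      rw [← sq_eq_sq₀ (norm_nonneg _) (norm_nonneg _)]
      exact (EllTwoZ.hasSum_norm_sq _).unique (hasSum_norm_sq_scatter h e ψ.hasSum_norm_sq) }

theorem sq_add_verblunskyRho_sq {α : 𝔻} {a : ℝ} (ha : (α : ℂ) = a) :
    a ^ 2 + verblunskyRho α ^ 2 = 1 := by
  have h1 := α.norm_lt_one
  rw [verblunskyRho, Real.sq_sqrt (by nlinarith [norm_nonneg (α : ℂ)]), ha, Complex.norm_real,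
    Real.norm_eq_abs, sq_abs]
  ring

theorem extendedCMV_mem_unitary {α : ℤ → 𝔻} {a : ℤ → ℝ} (ha : ∀ n, (α n : ℂ) = a n) :
    extendedCMV α ∈ unitary (EllTwoZ →L[ℂ] EllTwoZ) := by
  have h := fun n => sq_add_verblunskyRho_sq (ha n)
  have : extendedCMV α =
      (((scatterIsometry h 1).trans (scatterIsometry h 0) : EllTwoZ ≃ₗᵢ[ℂ] EllTwoZ) :
        EllTwoZ →L[ℂ] EllTwoZ) := by
    ext ψ n
    rw [extendedCMV_apply_eq_cmvAct ha, cmvAct_apply]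
    rfl
  rw [this]
  exact LinearIsometryEquiv.mem_unitary _

theorem cmvAct_eq_zero_of_notMem {ψ : ℤ → ℂ} {s t : ℤ} (hψ : ∀ n ∉ Finset.Icc s t, ψ n = 0)
    (a ρ : ℤ → ℝ) {n : ℤ} (hn : n ∉ Finset.Icc (s - 2) (t + 2)) : cmvAct a ρ ψ n = 0 := by
  have h : ∀ k ∈ Finset.Icc (-2 : ℤ) 2, ψ (n + k) = 0 := fun k hk => hψ _ (by
    simp only [Finset.mem_Icc] at hn hk ⊢
    omega)
  have h0 := h 0 (by decide)
  have h1 := h 1 (by decide)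
  have h2 := h 2 (by decide)
  have h3 := h (-1) (by decide)
  have h4 := h (-2) (by decide)
  rw [add_zero] at h0
  rw [← sub_eq_add_neg] at h3 h4
  by_cases hn' : Even n
  · simp [cmvAct_of_even hn', h0, h1, h2, h3]
  · simp [cmvAct_of_not_even hn', h0, h1, h3, h4]

theorem EllTwoZ.norm_sq_eq_sum {ψ : EllTwoZ} {s : Finset ℤ} (hψ : ∀ n ∉ s, ψ n = 0) :
    ‖ψ‖ ^ 2 = ∑ n ∈ s, ‖ψ n‖ ^ 2 :=
  ψ.hasSum_norm_sq.unique (hasSum_sum_of_ne_finset_zero fun n hn => by simp [hψ n hn])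

theorem norm_sq_extendedCMV_sub {α : ℤ → 𝔻} {a : ℤ → ℝ} (ha : ∀ n, (α n : ℂ) = a n) (z : ℂ)
    {ψ : EllTwoZ} {s t : ℤ} (hψ : ∀ n ∉ Finset.Icc s t, ψ n = 0) :
    ‖extendedCMV α ψ - z • ψ‖ ^ 2 = ∑ n ∈ Finset.Icc (s - 2) (t + 2),
      ‖cmvAct a (fun n => verblunskyRho (α n)) ψ n - z * ψ n‖ ^ 2 := by
  have happ : ∀ n, (extendedCMV α ψ - z • ψ) n =
      cmvAct a (fun n => verblunskyRho (α n)) ψ n - z * ψ n := fun n => by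
    rw [← extendedCMV_apply_eq_cmvAct ha]
    rfl
  rw [EllTwoZ.norm_sq_eq_sum (s := Finset.Icc (s - 2) (t + 2))]
  · simp only [happ]
  · intro n hn
    rw [happ, cmvAct_eq_zero_of_notMem hψ _ _ hn, hψ n, mul_zero, sub_zero]
    simp only [Finset.mem_Icc] at hn ⊢
    omega

/-- The constant is the squared norm of the inverse. The inequality mentions only finite sums, so it
can be passed to limits of the coefficients. -/
theorem exists_sum_le_of_notMem_spectrum {α : ℤ → 𝔻} {a : ℤ → ℝ} (ha : ∀ n, (α n : ℂ) = a n)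
    {z : ℂ} (hz : z ∉ spectrum ℂ (extendedCMV α)) :
    ∃ C : ℝ, ∀ (s t : ℤ) (ψ : ℤ → ℂ), (∀ n ∉ Finset.Icc s t, ψ n = 0) →
      ∑ n ∈ Finset.Icc s t, ‖ψ n‖ ^ 2 ≤ C * ∑ n ∈ Finset.Icc (s - 2) (t + 2),
        ‖cmvAct a (fun n => verblunskyRho (α n)) ψ n - z * ψ n‖ ^ 2 := by
  rw [spectrum.notMem_iff, IsUnit.sub_iff] at hz
  obtain ⟨u, hu⟩ := hz
  refine ⟨‖(↑u⁻¹ : EllTwoZ →L[ℂ] EllTwoZ)‖ ^ 2, fun s t ψ hψ => ?_⟩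
  have hmem : Memℓp ψ 2 := memℓp_gen (summable_of_ne_finset_zero (s := Finset.Icc s t)
    fun n hn => by simp [hψ n hn])
  let Ψ : EllTwoZ := ⟨ψ, hmem⟩
  have hux : (u : EllTwoZ →L[ℂ] EllTwoZ) Ψ = extendedCMV α Ψ - z • Ψ := by
    rw [hu]
    simp [Algebra.algebraMap_eq_smul_one]
  have h1 : Ψ = (↑u⁻¹ : EllTwoZ →L[ℂ] EllTwoZ) (extendedCMV α Ψ - z • Ψ) := by
    rw [← hux, ← mul_apply_eq_comp, u.inv_mul, one_apply_eq_self]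
  have h2 := EllTwoZ.norm_sq_eq_sum (ψ := Ψ) hψ
  have h3 := norm_sq_extendedCMV_sub ha z (ψ := Ψ) hψ
  have h4 : ‖Ψ‖ ≤ ‖(↑u⁻¹ : EllTwoZ →L[ℂ] EllTwoZ)‖ * ‖extendedCMV α Ψ - z • Ψ‖ := by
    nth_rw 1 [h1]
    exact ContinuousLinearMap.le_opNorm _ _
  have h5 := pow_le_pow_left₀ (norm_nonneg _) h4 2
  rw [mul_pow, h2, h3] at h5
  exact h5

theorem exists_sum_lt_of_mem_spectrum {α : ℤ → 𝔻} {a : ℤ → ℝ} (ha : ∀ n, (α n : ℂ) = a n)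
    {z : ℂ} (hz : z ∈ spectrum ℂ (extendedCMV α)) {ε : ℝ} (hε : 0 < ε) :
    ∃ (s t : ℤ) (ψ : ℤ → ℂ), (∀ n ∉ Finset.Icc s t, ψ n = 0) ∧
      ∑ n ∈ Finset.Icc (s - 2) (t + 2),
        ‖cmvAct a (fun n => verblunskyRho (α n)) ψ n - z * ψ n‖ ^ 2 <
      ε ^ 2 * ∑ n ∈ Finset.Icc s t, ‖ψ n‖ ^ 2 := by
  have hn := isStarNormal_of_mem_unitary (extendedCMV_mem_unitary ha)
  obtain ⟨Ψ, hΨ⟩ := ContinuousLinearMap.exists_norm_sub_lt_of_mem_spectrum hn hz hε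
  have hlim := lp.hasSum_single (p := 2) (by norm_num) Ψ
  -- The strict inequality is an open condition, so a finite truncation of the approximate
  -- eigenvector still satisfies it.
  have hopen : IsOpen {x : EllTwoZ | ‖extendedCMV α x - z • x‖ < ε * ‖x‖} :=
    isOpen_lt (by fun_prop) (by fun_prop)
  obtain ⟨S, hS⟩ := (hlim.eventually (hopen.mem_nhds hΨ)).exists
  set Φ : EllTwoZ := ∑ n ∈ S, lp.single 2 n (Ψ n) with hΦ
  obtain ⟨s, hs⟩ := S.bddBelow
  obtain ⟨t, ht⟩ := S.bddAbove
  have hsupp : ∀ n ∉ Finset.Icc s t, Φ n = 0 := by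
    intro n hn
    rw [hΦ, lp.coeFn_sum, Finset.sum_apply]
    refine Finset.sum_eq_zero fun m hm => ?_
    refine lp.single_apply_ne 2 m _ ?_
    rintro rfl
    exact hn (Finset.mem_Icc.2 ⟨hs hm, ht hm⟩)
  refine ⟨s, t, Φ, hsupp, ?_⟩
  rw [← norm_sq_extendedCMV_sub ha z hsupp, ← EllTwoZ.norm_sq_eq_sum hsupp, ← mul_pow]
  exact pow_lt_pow_left₀ hS (norm_nonneg _) two_ne_zero

/-! ### Antiperiodic extension from a window -/

section AntiperiodicExtension

variable {M : Type*} [AddCommGroup M] [Module ℂ M]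

/-- The representative modulo `N` of an integer in the window `[b, b + N)`. -/
def windowRep (b : ℤ) (N : ℕ) [NeZero N] (n : ℤ) : Finset.Ico b (b + N) :=
  ⟨b + (n - b) % N, by
    have hN : (0 : ℤ) < N := by exact_mod_cast NeZero.pos N
    have h1 := Int.emod_nonneg (n - b) hN.ne'
    have h2 := Int.emod_lt_of_pos (n - b) hN
    rw [Finset.mem_Ico]
    omega⟩

theorem windowRep_of_mem {b : ℤ} {N : ℕ} [NeZero N] {n : ℤ} (hn : n ∈ Finset.Ico b (b + N)) :
    windowRep b N n = ⟨n, hn⟩ := by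
  have hn' := Finset.mem_Ico.1 hn
  refine Subtype.ext ?_
  change b + (n - b) % N = n
  rw [Int.emod_eq_of_lt (by omega) (by omega), add_sub_cancel]

theorem windowRep_add (b : ℤ) (N : ℕ) [NeZero N] (n : ℤ) :
    windowRep b N (n + N) = windowRep b N n := by
  rw [windowRep, windowRep, Subtype.mk.injEq, add_sub_right_comm, Int.add_emod_right]

/-- The extension of a function on the window `[b, b + N)` to an `N`-antiperiodic sequence. -/
def antiExt (b : ℤ) (N : ℕ) [NeZero N] : (Finset.Ico b (b + N) → M) →ₗ[ℂ] (ℤ → M) where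
  toFun φ n := (-1 : ℂ) ^ ((n - b) / N) • φ (windowRep b N n)
  map_add' φ χ := by
    ext n
    simp
  map_smul' c φ := by
    ext n
    simp [smul_comm c]

variable (b : ℤ) (N : ℕ) [NeZero N]

theorem antiExt_apply (φ : Finset.Ico b (b + N) → M) (n : ℤ) :
    antiExt b N φ n = (-1 : ℂ) ^ ((n - b) / N) • φ (windowRep b N n) := rfl

theorem antiExt_of_mem (φ : Finset.Ico b (b + N) → M) {n : ℤ} (hn : n ∈ Finset.Ico b (b + N)) :
    antiExt b N φ n = φ ⟨n, hn⟩ := by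
  have hn' := Finset.mem_Ico.1 hn
  rw [antiExt_apply, Int.ediv_eq_zero_of_lt (by omega) (by omega), zpow_zero, one_smul,
    windowRep_of_mem hn]

theorem antiperiodic_antiExt (φ : Finset.Ico b (b + N) → M) :
    Function.Antiperiodic (antiExt b N φ) (N : ℤ) := by
  intro n
  have hN : (N : ℤ) ≠ 0 := by exact_mod_cast NeZero.ne N
  rw [antiExt_apply, antiExt_apply, windowRep_add, add_sub_right_comm, Int.add_ediv_of_dvd_right (dvd_refl _),
    Int.ediv_self hN, zpow_add_one₀ (by norm_num), mul_neg_one, neg_smul]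

theorem antiExt_restrict {ψ : ℤ → M} (hψ : Function.Antiperiodic ψ (N : ℤ)) :
    antiExt b N (fun n => ψ n) = ψ := by
  ext n
  have h : ∀ (m : ℕ) (k : ℤ), ψ (k + N * m) = (-1 : ℂ) ^ m • ψ k := by
    intro m
    induction m with
    | zero => simp
    | succ m ih =>
      intro k
      rw [Nat.cast_succ, mul_add_one, ← add_assoc, hψ, ih, pow_succ, mul_neg_one, neg_smul]
  have h' : ∀ (q : ℤ) (k : ℤ), ψ (k + N * q) = (-1 : ℂ) ^ q • ψ k := by
    intro q k
    obtain ⟨m, rfl | rfl⟩ := q.eq_nat_or_neg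
    · exact h m k
    · have h1 := h m (k + N * (-m))
      rw [mul_neg, neg_add_cancel_right] at h1
      rw [mul_neg, h1, smul_smul, zpow_neg, zpow_natCast, inv_mul_cancel₀ (by simp), one_smul]
  rw [antiExt_apply, ← h']
  congr 1
  have := Int.emod_add_mul_ediv (n - b) N
  simp only [windowRep]
  linarith

/-- Continues a one-sided orbit to the left without inverting transfer matrices. -/
theorem antiExt_nat {X : ℕ → M} (hX : ∀ k, X (k + N) = -X k) (k : ℕ) :
    antiExt b N (fun n => X (n - b : ℤ).toNat) (b + k) = X k := by
  induction k using Nat.strong_induction_on with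
  | _ k ih =>
    by_cases hk : k < N
    · rw [antiExt_of_mem b N _ (Finset.mem_Ico.2 ⟨by omega, by omega⟩)]
      simp
    · obtain ⟨j, rfl⟩ := Nat.exists_eq_add_of_le' (not_lt.1 hk)
      have hj := NeZero.pos N
      rw [Nat.cast_add, ← add_assoc, antiperiodic_antiExt, ih j (by omega), hX]

end AntiperiodicExtension

/-! ### Periodic coefficients acting on antiperiodic sequences -/

section Floquet

variable {a ρ : ℤ → ℝ} {N : ℕ}

theorem antiperiodic_cmvAct (hN : Even N) (ha : Function.Periodic a (N : ℤ))
    (hρ : Function.Periodic ρ (N : ℤ)) {ψ : ℤ → ℂ} (hψ : Function.Antiperiodic ψ (N : ℤ)) :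
    Function.Antiperiodic (cmvAct a ρ ψ) (N : ℤ) := by
  have hN' : Even (N : ℤ) := by exact_mod_cast hN
  rw [cmvAct_apply]
  exact antiperiodic_scatter hN' ha hρ 0 (antiperiodic_scatter hN' ha hρ 1 hψ)

theorem sum_norm_sq_cmvAct (h : ∀ n, a n ^ 2 + ρ n ^ 2 = 1) (hN : Even N)
    (ha : Function.Periodic a (N : ℤ)) (hρ : Function.Periodic ρ (N : ℤ)) (b : ℤ) {ψ : ℤ → ℂ}
    (hψ : Function.Antiperiodic ψ (N : ℤ)) :
    ∑ n ∈ Finset.Ico b (b + N), ‖cmvAct a ρ ψ n‖ ^ 2 =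
      ∑ n ∈ Finset.Ico b (b + N), ‖ψ n‖ ^ 2 := by
  have hN' : Even (N : ℤ) := by exact_mod_cast hN
  rw [cmvAct_apply, sum_norm_sq_scatter h hN ha hρ 0 b (antiperiodic_scatter hN' ha hρ 1 hψ),
    sum_norm_sq_scatter h hN ha hρ 1 b hψ]

/-- Over one period the flux increments cancel, so the norm over a window is conserved. The window
starts at a site where `ψ` does not vanish. The result is used to know that `z` has a logarithm. -/
theorem norm_eq_one_of_cmvAct_eq_smul [NeZero N] (h : ∀ n, a n ^ 2 + ρ n ^ 2 = 1) (hN : Even N)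
    (ha : Function.Periodic a (N : ℤ)) (hρ : Function.Periodic ρ (N : ℤ)) {ψ : ℤ → ℂ}
    (hψ : Function.Antiperiodic ψ (N : ℤ)) (hψ0 : ψ ≠ 0) {z : ℂ} (hz : cmvAct a ρ ψ = z • ψ) :
    ‖z‖ = 1 := by
  obtain ⟨b, hb⟩ := Function.ne_iff.1 hψ0
  have h1 := sum_norm_sq_cmvAct h hN ha hρ b hψ
  have hpos : 0 < ∑ n ∈ Finset.Ico b (b + N), ‖ψ n‖ ^ 2 := by
    refine Finset.sum_pos' (fun _ _ => by positivity) ⟨b, ?_, ?_⟩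
    · have := NeZero.pos N
      rw [Finset.mem_Ico]
      omega
    · exact pow_pos (norm_pos_iff.2 hb) 2
  simp only [hz, Pi.smul_apply, norm_smul, mul_pow, ← Finset.mul_sum] at h1
  have h2 : ‖z‖ ^ 2 = 1 := by
    rwa [mul_eq_right₀ hpos.ne'] at h1
  exact (pow_eq_one_iff_of_nonneg (norm_nonneg z) two_ne_zero).1 h2

/-- The action of the extended CMV matrix on `N`-antiperiodic sequences, seen in the window
`[b, b + N)`. -/
def floquetIsometry [NeZero N] (h : ∀ n, a n ^ 2 + ρ n ^ 2 = 1) (hN : Even N)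
    (ha : Function.Periodic a (N : ℤ)) (hρ : Function.Periodic ρ (N : ℤ)) (b : ℤ) :
    EuclideanSpace ℂ (Finset.Ico b (b + N)) →ₗᵢ[ℂ] EuclideanSpace ℂ (Finset.Ico b (b + N)) where
  toFun φ := WithLp.toLp 2 fun n => cmvAct a ρ (antiExt b N φ.ofLp) n
  map_add' φ χ := by
    ext n
    simp
  map_smul' c φ := by
    ext n
    simp
  norm_map' φ := by
    have h1 := sum_norm_sq_cmvAct h hN ha hρ b (antiperiodic_antiExt b N φ.ofLp)
    rw [← Finset.sum_coe_sort _ fun n => ‖cmvAct a ρ (antiExt b N φ.ofLp) n‖ ^ 2,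
      ← Finset.sum_coe_sort _ fun n => ‖antiExt b N φ.ofLp n‖ ^ 2] at h1
    rw [← sq_eq_sq₀ (norm_nonneg _) (norm_nonneg _), EuclideanSpace.norm_sq_eq,
      EuclideanSpace.norm_sq_eq]
    refine h1.trans (Finset.sum_congr rfl fun n _ => ?_)
    rw [antiExt_of_mem b N _ n.2]

theorem cmvAct_congr {a a' ρ ρ' : ℤ → ℝ} {ψ ψ' : ℤ → ℂ} {n : ℤ}
    (h : ∀ k ∈ Finset.Icc (n - 2) (n + 2), a k = a' k ∧ ρ k = ρ' k ∧ ψ k = ψ' k) :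
    cmvAct a ρ ψ n = cmvAct a' ρ' ψ' n := by
  have h0 := h n (Finset.mem_Icc.2 ⟨by omega, by omega⟩)
  have h1 := h (n + 1) (Finset.mem_Icc.2 ⟨by omega, by omega⟩)
  have h2 := h (n + 2) (Finset.mem_Icc.2 ⟨by omega, by omega⟩)
  have h3 := h (n - 1) (Finset.mem_Icc.2 ⟨by omega, by omega⟩)
  have h4 := h (n - 2) (Finset.mem_Icc.2 ⟨by omega, by omega⟩)
  by_cases hn : Even n
  · simp only [cmvAct_of_even hn, h0, h1, h2, h3]
  · simp only [cmvAct_of_not_even hn, h0, h1, h3, h4]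

/-- The support of `ψ` and of its image fits into one window, so `ψ` is equally good as a test
vector for the finite unitary matrix of the antiperiodic problem. Normality then yields a true
eigenvalue nearby. -/
theorem exists_antiperiodic_eigenvector [NeZero N] (h : ∀ n, a n ^ 2 + ρ n ^ 2 = 1) (hN : Even N)
    (ha : Function.Periodic a (N : ℤ)) (hρ : Function.Periodic ρ (N : ℤ)) {b s t : ℤ}
    (hs : b ≤ s - 2) (ht : t + 2 < b + N) {ψ : ℤ → ℂ} (hψ : ∀ n ∉ Finset.Icc s t, ψ n = 0)
    {z : ℂ} {ε : ℝ} (hε : 0 < ε)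
    (hlt : ∑ n ∈ Finset.Icc (s - 2) (t + 2), ‖cmvAct a ρ ψ n - z * ψ n‖ ^ 2 <
      ε ^ 2 * ∑ n ∈ Finset.Icc s t, ‖ψ n‖ ^ 2) :
    ∃ (y : ℂ) (φ : ℤ → ℂ), Function.Antiperiodic φ (N : ℤ) ∧ φ ≠ 0 ∧
      cmvAct a ρ φ = y • φ ∧ ‖y - z‖ < ε := by
  have hst : s ≤ t := by
    by_contra! hst
    rw [Finset.Icc_eq_empty_of_lt hst, Finset.sum_empty, mul_zero] at hlt
    exact hlt.not_ge (Finset.sum_nonneg fun _ _ => by positivity)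
  set U := (floquetIsometry h hN ha hρ b).toLinearIsometryEquiv rfl with hU
  set T : EuclideanSpace ℂ (Finset.Ico b (b + N)) →L[ℂ] EuclideanSpace ℂ (Finset.Ico b (b + N)) :=
    (U : EuclideanSpace ℂ (Finset.Ico b (b + N)) →L[ℂ] EuclideanSpace ℂ (Finset.Ico b (b + N)))
    with hT
  have hTapp : ∀ φ n, T φ n = cmvAct a ρ (antiExt b N φ.ofLp) n := fun _ _ => rfl
  have hnormal : IsStarNormal T := isStarNormal_of_mem_unitary (LinearIsometryEquiv.mem_unitary U)
  set x : EuclideanSpace ℂ (Finset.Ico b (b + N)) := WithLp.toLp 2 fun n => ψ n with hx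
  -- The band reaches two sites beyond the window. There the extension copies, up to sign, the sites
  -- at the opposite end, where the margins make `ψ` vanish.
  have hext : ∀ n ∈ Finset.Icc (b - 2) (b + N + 1), antiExt b N x.ofLp n = ψ n := by
    intro n hn
    rw [Finset.mem_Icc] at hn
    by_cases h1 : n ∈ Finset.Ico b (b + N)
    · rw [antiExt_of_mem b N _ h1]
    rw [Finset.mem_Ico] at h1
    rw [hψ n (by rw [Finset.mem_Icc]; omega)]
    have hz : ∀ m, m ∈ Finset.Ico b (b + N) → m ∉ Finset.Icc s t → antiExt b N x.ofLp m = 0 :=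
      fun m h2 h3 => by rw [antiExt_of_mem b N _ h2]; exact hψ m h3
    by_cases h2 : n < b
    · have h3 := antiperiodic_antiExt b N x.ofLp n
      rw [hz (n + N) (by rw [Finset.mem_Ico]; omega) (by rw [Finset.mem_Icc]; omega)] at h3
      exact neg_eq_zero.1 h3.symm
    · have h3 := antiperiodic_antiExt b N x.ofLp (n - N)
      rw [sub_add_cancel, hz (n - N) (by rw [Finset.mem_Ico]; omega)
        (by rw [Finset.mem_Icc]; omega), neg_zero] at h3
      exact h3
  have hTx : ∀ n : Finset.Ico b (b + N), (T x - z • x) n = cmvAct a ρ ψ n - z * ψ n := by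
    intro n
    have hn := Finset.mem_Ico.1 n.2
    have : T x n = cmvAct a ρ ψ n := by
      rw [hTapp]
      refine cmvAct_congr fun k hk => ⟨rfl, rfl, hext k ?_⟩
      rw [Finset.mem_Icc] at hk ⊢
      omega
    rw [← this]
    rfl
  have hsub : Finset.Icc (s - 2) (t + 2) ⊆ Finset.Ico b (b + N) := fun n hn => by
    rw [Finset.mem_Icc] at hn
    rw [Finset.mem_Ico]
    omega
  have hsub' : Finset.Icc s t ⊆ Finset.Icc (s - 2) (t + 2) :=
    Finset.Icc_subset_Icc (by omega) (by omega)
  have h1 : ‖T x - z • x‖ ^ 2 =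
      ∑ n ∈ Finset.Icc (s - 2) (t + 2), ‖cmvAct a ρ ψ n - z * ψ n‖ ^ 2 := by
    rw [EuclideanSpace.norm_sq_eq]
    simp only [hTx]
    rw [Finset.sum_coe_sort (Finset.Ico b (b + N)) fun n => ‖cmvAct a ρ ψ n - z * ψ n‖ ^ 2]
    refine (Finset.sum_subset hsub fun n _ hn => ?_).symm
    rw [cmvAct_eq_zero_of_notMem hψ _ _ hn, hψ n fun hn' => hn (hsub' hn')]
    simp
  have h2 : ‖x‖ ^ 2 = ∑ n ∈ Finset.Icc s t, ‖ψ n‖ ^ 2 := by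
    rw [EuclideanSpace.norm_sq_eq,
      Finset.sum_coe_sort (Finset.Ico b (b + N)) fun n => ‖ψ n‖ ^ 2]
    exact (Finset.sum_subset (hsub'.trans hsub) fun n _ hn => by simp [hψ n hn]).symm
  rw [← h1, ← h2, ← mul_pow] at hlt
  have h3 := lt_of_pow_lt_pow_left₀ 2 (by positivity) hlt
  obtain ⟨y, hy, hyz⟩ := ContinuousLinearMap.exists_mem_spectrum_of_norm_sub_lt hnormal h3
  rw [ContinuousLinearMap.spectrum_eq, ← Module.End.hasEigenvalue_iff_mem_spectrum] at hy
  obtain ⟨φ, hφ⟩ := hy.exists_hasEigenvector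
  have hφT : T φ = y • φ := hφ.apply_eq_smul
  refine ⟨y, antiExt b N φ.ofLp, antiperiodic_antiExt b N _, ?_, ?_, hyz⟩
  · intro h0
    refine hφ.2 ?_
    ext n
    rw [← antiExt_of_mem b N φ.ofLp n.2, h0]
    rfl
  -- Both sides are antiperiodic, so equality on the window suffices.
  · rw [← antiExt_restrict b N
      (antiperiodic_cmvAct hN ha hρ (antiperiodic_antiExt b N φ.ofLp)), ← map_smul]
    congr 1
    ext n
    rw [← hTapp, hφT]
    rfl

end Floquet

/-! ### Ising transfer matrices and the CMV eigenvalue equation -/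

section Transfer

open Matrix

/-- The transfer matrix of the Ising chain, normalized to determinant one. -/
def isingTransfer (w : ℂ) (a ρ : ℝ) : Matrix (Fin 2) (Fin 2) ℂ :=
  (ρ : ℂ)⁻¹ • !![w, a * w; a * w⁻¹, w⁻¹]

/-- The product of the transfer matrices at the sites `b, b + 1, …, b + k - 1`. -/
def isingMonodromy (w : ℂ) (a ρ : ℤ → ℝ) (b : ℤ) : ℕ → Matrix (Fin 2) (Fin 2) ℂ
  | 0 => 1
  | k + 1 => isingMonodromy w a ρ b k * isingTransfer w (a (b + k)) (ρ (b + k))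

variable {w : ℂ} {a ρ : ℤ → ℝ}

theorem det_isingTransfer (hw : w ≠ 0) {x y : ℝ} (h : x ^ 2 + y ^ 2 = 1) (hy : 0 < y) :
    (isingTransfer w x y).det = 1 := by
  have h' : (x : ℂ) ^ 2 + (y : ℂ) ^ 2 = 1 := by exact_mod_cast h
  have hy' : (y : ℂ) ≠ 0 := by exact_mod_cast hy.ne'
  rw [isingTransfer, det_smul, det_fin_two_of]
  simp only [Fintype.card_fin]
  field_simp
  linear_combination -h'

theorem det_isingMonodromy (hw : w ≠ 0) (h : ∀ n, a n ^ 2 + ρ n ^ 2 = 1) (hρ : ∀ n, 0 < ρ n)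
    (b : ℤ) (k : ℕ) : (isingMonodromy w a ρ b k).det = 1 := by
  induction k with
  | zero => simp [isingMonodromy]
  | succ k ih => rw [isingMonodromy, det_mul, ih, det_isingTransfer hw (h _) (hρ _), one_mul]

theorem isingMonodromy_add {p : ℕ} (hap : Function.Periodic a (p : ℤ))
    (hρp : Function.Periodic ρ (p : ℤ)) (b : ℤ) (k : ℕ) :
    isingMonodromy w a ρ b (p + k) = isingMonodromy w a ρ b p * isingMonodromy w a ρ b k := by
  induction k with
  | zero => simp [isingMonodromy]
  | succ k ih =>
    rw [← add_assoc, isingMonodromy, ih, isingMonodromy, Nat.cast_add, add_comm (p : ℤ),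
      ← add_assoc, hap, hρp, mul_assoc]

theorem Matrix.mul_self_of_det_eq_one {A : Matrix (Fin 2) (Fin 2) ℂ} (hA : A.det = 1) :
    A * A = A.trace • A - 1 := by
  rw [det_fin_two] at hA
  ext i j
  fin_cases i <;> fin_cases j <;>
    simp [Matrix.mul_apply, Fin.sum_univ_two, Matrix.trace_fin_two] <;>
    first | ring1 | linear_combination -hA

/-- Two sequences that satisfy the scattering relations `w g n = a n f n + ρ n g (n + 1)`,
`w f (n + 1) = ρ n f n - a n g (n + 1)` evolve by the Ising transfer matrices. -/
theorem scattering_iff_vecMul_isingTransfer (hw : w ≠ 0) {x y : ℝ} (h : x ^ 2 + y ^ 2 = 1)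
    (hy : 0 < y) (g f g' f' : ℂ) :
    (w * g = x * f + y * g' ∧ w * f' = y * f - x * g') ↔
      ![g', -w * f'] = ![g, -w * f] ᵥ* isingTransfer w x y := by
  have h' : (x : ℂ) ^ 2 + (y : ℂ) ^ 2 = 1 := by exact_mod_cast h
  have hy' : (y : ℂ) ≠ 0 := by exact_mod_cast hy.ne'
  have hrhs : ![g, -w * f] ᵥ* isingTransfer w x y =
      ![(y : ℂ)⁻¹ * (w * g - x * f), (y : ℂ)⁻¹ * (x * w * g - f)] := by
    rw [isingTransfer, vecMul_smul]
    ext i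
    fin_cases i <;> simp [-mul_eq_mul_left_iff] <;>
      field_simp <;> ring
  rw [hrhs]
  constructor
  · rintro ⟨h1, h2⟩
    congrm ![?_, ?_]
    · rw [h1]
      field_simp
      ring
    · rw [neg_mul, h2]
      field_simp
      linear_combination - (x : ℂ) * h1 - f * h'
  · intro heq
    have h1 : g' = (y : ℂ)⁻¹ * (w * g - x * f) := congrFun heq 0
    have h2 : -w * f' = (y : ℂ)⁻¹ * (x * w * g - f) := congrFun heq 1
    have h1' : (y : ℂ) * g' = w * g - x * f := by
      rw [h1]
      field_simp
    refine ⟨by linear_combination -h1', ?_⟩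
    have h2' : (y : ℂ) * (-w * f') = x * w * g - f := by
      rw [h2]
      field_simp
    refine mul_left_cancel₀ hy' ?_
    linear_combination -h2' + (x : ℂ) * h1' - f * h'

/-- Interleaving `f` and `g` by parity turns the scattering relations, which do not see parity, into
the action of the reflections, which do. With `e = 1` and then `e = 0` this composes to the CMV
matrix with eigenvalue `w ^ 2`. -/
theorem scatter_of_scattering {f g : ℤ → ℂ}
    (h : ∀ n, w * g n = a n * f n + ρ n * g (n + 1) ∧ w * f (n + 1) = ρ n * f n - a n * g (n + 1))
    (e : ℤ) : scatter e a ρ (fun n => if Even (n + e) then f n else g n) =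
      fun n => w * if Even (n + e) then g n else f n := by
  ext n
  by_cases hn : Even (n + e)
  · rw [scatter_of_even hn]
    have hn' : ¬ Even (n + 1 + e) := by grind
    simp only [if_pos hn, if_neg hn', (h n).1]
  · rw [scatter_of_not_even hn]
    have hn' : Even (n - 1 + e) := by grind
    have := (h (n - 1)).2
    rw [sub_add_cancel] at this
    simp only [if_neg hn, if_pos hn', this]

theorem scattering_of_scatter {f g : ℤ → ℂ}
    (h : ∀ e ∈ ({0, 1} : Finset ℤ), scatter e a ρ (fun n => if Even (n + e) then f n else g n) =
      fun n => w * if Even (n + e) then g n else f n) (n : ℤ) :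
    w * g n = a n * f n + ρ n * g (n + 1) ∧ w * f (n + 1) = ρ n * f n - a n * g (n + 1) := by
  obtain ⟨e, he, hn⟩ : ∃ e ∈ ({0, 1} : Finset ℤ), Even (n + e) := by
    by_cases hn : Even n
    · exact ⟨0, by simp, by simpa using hn⟩
    · exact ⟨1, by simp, by grind⟩
  have hn' : ¬ Even (n + 1 + e) := by grind
  have h1 := congrFun (h e he) n
  have h2 := congrFun (h e he) (n + 1)
  rw [scatter_of_even hn] at h1
  rw [scatter_succ_of_even hn] at h2
  simp only [if_pos hn, if_neg hn'] at h1 h2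
  exact ⟨h1.symm, h2.symm⟩

variable {p : ℕ}

theorem Function.Periodic.two_mul_nat {a : ℤ → ℝ} (ha : Function.Periodic a (p : ℤ)) :
    Function.Periodic a ((2 * p : ℕ) : ℤ) := by
  rw [Nat.cast_mul]
  exact ha.nat_mul 2

theorem exists_antiperiodic_of_trace_eq_zero [NeZero p] (hw : w ≠ 0)
    (h : ∀ n, a n ^ 2 + ρ n ^ 2 = 1) (hρ : ∀ n, 0 < ρ n)
    (hap : Function.Periodic a (p : ℤ)) (hρp : Function.Periodic ρ (p : ℤ)) {b : ℤ}
    (htr : (isingMonodromy w a ρ b p).trace = 0) :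
    ∃ u : ℤ → ℂ, Function.Antiperiodic u ((2 * p : ℕ) : ℤ) ∧ u ≠ 0 ∧
      cmvAct a ρ u = w ^ 2 • u := by
  set N := 2 * p with hN
  have : NeZero N := ⟨by have := NeZero.ne p; omega⟩
  -- Cayley–Hamilton with vanishing trace: the product over the doubled period is `-1`, so every
  -- orbit is antiperiodic.
  have hmon : isingMonodromy w a ρ b N = -1 := by
    rw [hN, two_mul, isingMonodromy_add hap hρp,
      Matrix.mul_self_of_det_eq_one (det_isingMonodromy hw h hρ b p), htr, zero_smul, zero_sub]
  -- Any nonzero starting vector would do; this one gives `g b = 1`, which shows `u ≠ 0` at the end.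
  set X : ℕ → Fin 2 → ℂ := fun k => ![1, 0] ᵥ* isingMonodromy w a ρ b k with hX
  have hXN : ∀ k, X (k + N) = -X k := fun k => by
    simp only [hX]
    rw [add_comm, isingMonodromy_add hap.two_mul_nat hρp.two_mul_nat, hmon, neg_one_mul,
      vecMul_neg]
  have hXs : ∀ k : ℕ, X (k + 1) = X k ᵥ* isingTransfer w (a (b + k)) (ρ (b + k)) := fun k => by
    simp only [hX]
    rw [isingMonodromy, vecMul_vecMul]
  set Y : ℤ → Fin 2 → ℂ := antiExt b N fun n => X (n - b : ℤ).toNat with hY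
  have hYX : ∀ k : ℕ, Y (b + k) = X k := antiExt_nat b N hXN
  have hYN : Function.Antiperiodic Y (N : ℤ) := antiperiodic_antiExt b N _
  have hYs : ∀ n, Y (n + 1) = Y n ᵥ* isingTransfer w (a n) (ρ n) := by
    -- To the right of `b` this is the recursion of `X`; elsewhere, translating by multiples of `N`
    -- only changes signs.
    have key : ∀ (m : ℕ) (n : ℤ), b ≤ n + N * m →
        Y (n + 1) = Y n ᵥ* isingTransfer w (a n) (ρ n) := by
      intro m
      induction m with
      | zero =>
        intro n hn
        obtain ⟨k, hk⟩ := Int.le.dest (by simpa using hn)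
        rw [← hk, hYX, ← hXs, add_assoc]
        exact hYX (k + 1)
      | succ m ih =>
        intro n hn
        have h1 := ih (n + N) (by push_cast at hn; linarith)
        rw [add_right_comm, hYN, hYN, hap.two_mul_nat, hρp.two_mul_nat, neg_vecMul] at h1
        exact neg_injective h1
    intro n
    refine key (b - n).toNat n ?_
    have h1 := Int.self_le_toNat (b - n)
    have h2 : (1 : ℤ) ≤ N := by exact_mod_cast NeZero.pos N
    nlinarith
  set g : ℤ → ℂ := fun n => Y n 0 with hg
  set f : ℤ → ℂ := fun n => -w⁻¹ * Y n 1 with hf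
  have hYfg : ∀ n, ![g n, -w * f n] = Y n := fun n => by
    ext i
    fin_cases i
    · rfl
    · simp [hf, hw]
  have hwalk : ∀ n, w * g n = a n * f n + ρ n * g (n + 1) ∧
      w * f (n + 1) = ρ n * f n - a n * g (n + 1) := fun n => by
    rw [scattering_iff_vecMul_isingTransfer hw (h n) (hρ n), hYfg, hYfg, hYs]
  have hgN : ∀ n, g (n + N) = -g n := fun n => by simp [hg, hYN n]
  have hfN : ∀ n, f (n + N) = -f n := fun n => by simp [hf, hYN n]
  set u : ℤ → ℂ := fun n => if Even n then g n else f n with hu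
  set v : ℤ → ℂ := fun n => if Even n then f n else g n with hv
  have huv : scatter 1 a ρ u = w • v := by
    have hu1 : u = fun n => if Even (n + 1) then f n else g n := by
      ext n
      simp only [hu, Int.even_add_one, ite_not]
    rw [hu1, scatter_of_scattering hwalk 1]
    ext n
    simp only [hv, Pi.smul_apply, smul_eq_mul, Int.even_add_one, ite_not]
  have hvu : scatter 0 a ρ v = w • u := by
    have hv0 : v = fun n => if Even (n + 0) then f n else g n := by simp only [hv, add_zero]
    rw [hv0, scatter_of_scattering hwalk 0]
    ext n
    simp only [hu, Pi.smul_apply, smul_eq_mul, add_zero]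
  refine ⟨u, fun n => ?_, fun hu0 => ?_, ?_⟩
  · have : Even (n + N) ↔ Even n := by
      rw [hN, Nat.cast_mul]
      grind
    simp only [hu, this, hgN, hfN]
    split_ifs <;> rfl
  · rw [hu0, map_zero, eq_comm, smul_eq_zero_iff_right hw] at huv
    have hg0 : g b = 0 := by
      by_cases hb : Even b
      · simpa [hu, hb] using congrFun hu0 b
      · simpa [hv, hb] using congrFun huv b
    have : g b = 1 := by
      have h1 := hYX 0
      rw [Nat.cast_zero, add_zero] at h1
      simp [hg, h1, hX, isingMonodromy]
    exact one_ne_zero (this.symm.trans hg0)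
  · rw [cmvAct_apply, huv, map_smul, hvu, smul_smul, sq]

theorem trace_eq_zero_of_antiperiodic (hw : w ≠ 0)
    (h : ∀ n, a n ^ 2 + ρ n ^ 2 = 1) (hρ : ∀ n, 0 < ρ n)
    (hap : Function.Periodic a (p : ℤ)) (hρp : Function.Periodic ρ (p : ℤ)) (b : ℤ)
    {u : ℤ → ℂ} (hu : Function.Antiperiodic u ((2 * p : ℕ) : ℤ)) (hu0 : u ≠ 0)
    (heig : cmvAct a ρ u = w ^ 2 • u) : (isingMonodromy w a ρ b p).trace = 0 := by
  set v : ℤ → ℂ := w⁻¹ • scatter 1 a ρ u with hv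
  have huv : scatter 1 a ρ u = w • v := by rw [hv, smul_inv_smul₀ hw]
  have hvu : scatter 0 a ρ v = w • u := by
    rw [hv, map_smul, ← cmvAct_apply, heig, sq, ← smul_smul, inv_smul_smul₀ hw]
  have hEv : Even ((2 * p : ℕ) : ℤ) := by
    rw [Nat.cast_mul]
    grind
  have hvN : Function.Antiperiodic v ((2 * p : ℕ) : ℤ) := fun n => by
    rw [hv, Pi.smul_apply, Pi.smul_apply,
      antiperiodic_scatter hEv hap.two_mul_nat hρp.two_mul_nat 1 hu, smul_neg]
  set g : ℤ → ℂ := fun n => if Even n then u n else v n with hg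
  set f : ℤ → ℂ := fun n => if Even n then v n else u n with hf
  have hwalk : ∀ n, w * g n = a n * f n + ρ n * g (n + 1) ∧
      w * f (n + 1) = ρ n * f n - a n * g (n + 1) := by
    refine scattering_of_scatter fun e he => ?_
    rw [Finset.mem_insert, Finset.mem_singleton] at he
    rcases he with rfl | rfl
    · have h1 : (fun n => if Even (n + 0) then f n else g n) = v := by
        ext n
        simp only [hf, hg, add_zero]
        split_ifs <;> rfl
      rw [h1, hvu]
      ext n
      simp only [hf, hg, add_zero, Pi.smul_apply, smul_eq_mul]
      split_ifs <;> rfl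
    · have h1 : (fun n => if Even (n + 1) then f n else g n) = u := by
        ext n
        simp only [hf, hg, Int.even_add_one]
        split_ifs <;> rfl
      rw [h1, huv]
      ext n
      simp only [hf, hg, Int.even_add_one, Pi.smul_apply, smul_eq_mul]
      split_ifs <;> rfl
  set Y : ℤ → Fin 2 → ℂ := fun n => ![g n, -w * f n] with hY
  have hYs : ∀ n, Y (n + 1) = Y n ᵥ* isingTransfer w (a n) (ρ n) := fun n =>
    (scattering_iff_vecMul_isingTransfer hw (h n) (hρ n) _ _ _ _).1 (hwalk n)
  have hYk : ∀ k : ℕ, Y (b + k) = Y b ᵥ* isingMonodromy w a ρ b k := by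
    intro k
    induction k with
    | zero => simp [isingMonodromy]
    | succ k ih => rw [isingMonodromy, ← vecMul_vecMul, ← ih, ← hYs, Nat.cast_succ, add_assoc]
  have hYN : ∀ n, Y (n + (2 * p : ℕ)) = -Y n := fun n => by
    have : Even (n + ((2 * p : ℕ) : ℤ)) ↔ Even n := by grind
    simp only [hY, hg, hf, this, hu n, hvN n]
    ext i
    fin_cases i <;> simp <;> split_ifs <;> simp
  set P := isingMonodromy w a ρ b p with hP
  have hdet : P.det = 1 := det_isingMonodromy hw h hρ b p
  -- Antiperiodicity gives `Y b ᵥ* (P * P) = -Y b`, and Cayley–Hamilton leaves only the trace term.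
  -- Since `P` is invertible, a nonzero trace would force `Y b = 0` and so `u = 0`.
  have h1 : P.trace • (Y b ᵥ* P) = 0 := by
    have h2 := hYk (2 * p)
    rw [hYN, two_mul, isingMonodromy_add hap hρp, ← hP, Matrix.mul_self_of_det_eq_one hdet,
      vecMul_sub, vecMul_one, vecMul_smul, eq_comm, sub_eq_neg_self] at h2
    exact h2
  rcases smul_eq_zero.1 h1 with h2 | h2
  · exact h2
  have hYb : Y b = 0 := by
    have h3 := congrArg (· ᵥ* P⁻¹) h2
    simpa [vecMul_vecMul, Matrix.mul_nonsing_inv P (by simp [hdet])] using h3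
  refine absurd ?_ hu0
  ext n
  have hYn : Y n = 0 := by
    -- For period zero, antiperiodicity itself says `Y n = -Y n`.
    rcases Nat.eq_zero_or_pos p with rfl | hp
    · have h3 := hYN n
      simp only [mul_zero, Nat.cast_zero, add_zero] at h3
      exact self_eq_neg.1 h3
    have key : ∀ (m : ℕ) (n : ℤ), b ≤ n + (2 * p : ℕ) * m → Y n = 0 := by
      intro m
      induction m with
      | zero =>
        intro n hn
        obtain ⟨k, hk⟩ := Int.le.dest (by simpa using hn)
        rw [← hk, hYk, hYb, zero_vecMul]
      | succ m ih =>
        intro n hn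
        have h1 := ih (n + (2 * p : ℕ)) (by push_cast at hn ⊢; linarith)
        rwa [hYN, neg_eq_zero] at h1
    refine key (b - n).toNat n ?_
    have h1 := Int.self_le_toNat (b - n)
    have h2 : (1 : ℤ) ≤ (2 * p : ℕ) := by omega
    nlinarith
  have h3 : g n = 0 := congrFun hYn 0
  have h4 : -w * f n = 0 := congrFun hYn 1
  have h5 : f n = 0 := by simpa [hw] using h4
  by_cases hn : Even n
  · simpa [hg, hn] using h3
  · simpa [hf, hn] using h5

end Transfer

/-! ### The partition function as a trace -/

section PartitionFunction

/-- The weight `F` of the two ends is left free so that the induction can absorb the last step into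
it. It later serves as the bond that closes the ring. -/
theorem sum_path_eq_sum_matrix_prod {S R : Type*} [Fintype S] [DecidableEq S] [CommRing R]
    {T P : ℕ → Matrix S S R} (hP0 : P 0 = 1) (hPs : ∀ k, P (k + 1) = P k * T k) (n : ℕ)
    (F : S → S → R) :
    ∑ σ : Fin (n + 1) → S, F (σ 0) (σ (Fin.last n)) *
      ∏ j : Fin n, T j (σ j.castSucc) (σ j.succ) = ∑ i, ∑ c, F i c * P n i c := by
  induction n generalizing F with
  | zero =>
    rw [← (Equiv.funUnique (Fin 1) S).symm.sum_comp]
    simp [hP0, Matrix.one_apply]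
  | succ n ih =>
    rw [← (Fin.snocEquiv fun _ : Fin (n + 2) => S).sum_comp, Fintype.sum_prod_type]
    have h1 : ∀ c : S, ∑ σ : Fin (n + 1) → S,
        F (σ 0) c * ((∏ j : Fin n, T j (σ j.castSucc) (σ j.succ)) * T n (σ (Fin.last n)) c) =
        ∑ i, F i c * P (n + 1) i c := by
      intro c
      rw [hPs]
      simp only [Matrix.mul_apply, Finset.mul_sum]
      have h2 := ih fun i d => F i c * T n d c
      refine Eq.trans (Finset.sum_congr rfl fun σ _ => ?_) (h2.trans
        (Finset.sum_congr rfl fun i _ => Finset.sum_congr rfl fun d _ => ?_)) <;> ring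
    rw [Finset.sum_comm (f := fun i c => F i c * P (n + 1) i c)]
    refine Finset.sum_congr rfl fun c _ => (Eq.trans ?_ (h1 c))
    refine Finset.sum_congr rfl fun σ _ => ?_
    rw [Fin.prod_univ_castSucc]
    have h0 : ∀ j : Fin (n + 1), (Fin.snocEquiv fun _ : Fin (n + 2) => S) (c, σ) j.castSucc = σ j :=
      fun j => Fin.snoc_castSucc (α := fun _ => S) c σ j
    have hl : (Fin.snocEquiv fun _ : Fin (n + 2) => S) (c, σ) (Fin.last (n + 1)) = c :=
      Fin.snoc_last (α := fun _ => S) c σ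
    have h3 := h0 0
    rw [Fin.castSucc_zero] at h3
    simp only [Fin.val_castSucc, Fin.val_last, ← Fin.castSucc_succ, h0, h3, Fin.succ_last, hl]

/-- The sites of the lattice, numbered from the left. -/
def isingSiteEquiv (l r : ℕ) : Fin (l + r + 1) ≃ IsingSite l r where
  toFun j := ⟨-(l : ℤ) + j, Finset.mem_Icc.2 ⟨by omega, by omega⟩⟩
  invFun x := ⟨((x : ℤ) + l).toNat, by have := Finset.mem_Icc.1 x.2; omega⟩
  left_inv j := by
    ext
    simp
  right_inv x := by
    have := Finset.mem_Icc.1 x.2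
    ext
    simp only
    omega

/-- The two spins, numbered. -/
def spinEquiv : Fin 2 ≃ ℤˣ where
  toFun := ![1, -1]
  invFun s := if s = 1 then 0 else 1
  left_inv i := by fin_cases i <;> simp
  right_inv s := by rcases Int.units_eq_one_or s with rfl | rfl <;> simp

theorem isingSiteEquiv_coe (l r : ℕ) (j : Fin (l + r + 1)) :
    (isingSiteEquiv l r j : ℤ) = -(l : ℤ) + j := rfl

theorem next_isingSiteEquiv_castSucc (l r : ℕ) (j : Fin (l + r)) :
    (isingSiteEquiv l r j.castSucc).next = isingSiteEquiv l r j.succ := by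
  have h : ((isingSiteEquiv l r j.castSucc : IsingSite l r) : ℤ) + 1 ≤ r := by
    rw [isingSiteEquiv_coe, Fin.val_castSucc]
    omega
  ext
  rw [IsingSite.next, dif_pos h]
  change (isingSiteEquiv l r j.castSucc : ℤ) + 1 = _
  rw [isingSiteEquiv_coe, isingSiteEquiv_coe, Fin.val_castSucc, Fin.val_succ, Nat.cast_succ,
    add_assoc]

theorem next_isingSiteEquiv_last (l r : ℕ) :
    (isingSiteEquiv l r (Fin.last (l + r))).next = isingSiteEquiv l r 0 := by
  have h : ¬ ((isingSiteEquiv l r (Fin.last (l + r)) : IsingSite l r) : ℤ) + 1 ≤ r := by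
    rw [isingSiteEquiv_coe, Fin.val_last]
    omega
  ext
  rw [IsingSite.next, dif_neg h, isingSiteEquiv_coe, Fin.val_zero, Nat.cast_zero, add_zero]

/-- The Boltzmann weight of a bond, with the field attached to its left spin. Dividing by the weight
of aligned spins leaves `Real.exp (-2 * (β * x))` for opposite spins, which is the Verblunsky
coefficient. -/
theorem exp_eq_mul_isingTransfer {β x ρ : ℝ} (hρ : ρ ≠ 0) (H : ℂ) (s t : Fin 2) :
    Complex.exp (β * (x * (spinEquiv s : ℤ) * (spinEquiv t : ℤ) + H * (spinEquiv s : ℤ))) =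
      Complex.exp (β * x) * ρ *
        isingTransfer (Complex.exp (β * H)) (Real.exp (-2 * (β * x))) ρ s t := by
  have hρ' : (ρ : ℂ) ≠ 0 := by exact_mod_cast hρ
  have htwo : Complex.exp (2 * (β * x)) = Complex.exp (β * x) * Complex.exp (β * x) := by
    rw [two_mul, Complex.exp_add]
  have h0 := Complex.exp_ne_zero (β * x)
  fin_cases s <;> fin_cases t <;>
    simp [spinEquiv, isingTransfer, mul_add, Complex.exp_add, Complex.exp_neg, htwo] <;> field_simp

theorem partitionFunction_eq_mul_trace (J : ℤ → ℝ) (kB τ : ℝ) {ρ : ℤ → ℝ} (hρ : ∀ n, ρ n ≠ 0)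
    (l r : ℕ) (H : ℂ) :
    partitionFunction J kB τ l r H =
      (∏ j : Fin (l + r + 1), Complex.exp (((kB * τ)⁻¹ : ℝ) * J (-l + j)) * ρ (-l + j)) *
      (isingMonodromy (Complex.exp (((kB * τ)⁻¹ : ℝ) * H))
        (fun n => Real.exp (-2 * ((kB * τ)⁻¹ * J n))) ρ (-l) (l + r + 1)).trace := by
  set β : ℝ := (kB * τ)⁻¹ with hβ
  set w := Complex.exp (β * H) with hw
  set a : ℤ → ℝ := fun n => Real.exp (-2 * (β * J n)) with ha
  set T : ℕ → Matrix (Fin 2) (Fin 2) ℂ := fun k => isingTransfer w (a (-l + k)) (ρ (-l + k)) with hT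
  have hpath := sum_path_eq_sum_matrix_prod (T := T) (P := isingMonodromy w a ρ (-l)) rfl
    (fun _ => rfl) (l + r) fun i c => T (l + r) c i
  have htrace : (isingMonodromy w a ρ (-l) (l + r + 1)).trace =
      ∑ i, ∑ c, T (l + r) c i * isingMonodromy w a ρ (-l) (l + r) i c := by
    simp only [isingMonodromy, Matrix.trace, Matrix.diag_apply, Matrix.mul_apply, hT,
      Nat.cast_add, mul_comm]
  rw [htrace, ← hpath, partitionFunction, Finset.mul_sum,
    ← (Equiv.arrowCongr (isingSiteEquiv l r) spinEquiv).sum_comp]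
  refine Finset.sum_congr rfl fun σ _ => ?_
  have hσ : ∀ j, (Equiv.arrowCongr (isingSiteEquiv l r) spinEquiv σ) (isingSiteEquiv l r j) =
      spinEquiv (σ j) := fun j => by simp
  rw [isingEnergy, neg_mul, neg_neg, Finset.mul_sum, Complex.exp_sum,
    ← (isingSiteEquiv l r).prod_comp]
  have hβ' : 1 / ((kB : ℂ) * τ) = (β : ℝ) := by
    rw [hβ]
    push_cast
    rw [one_div]
  have hexp := fun n => exp_eq_mul_isingTransfer (β := β) (x := J n) (hρ n) H
  simp only [hβ', hσ, isingSiteEquiv_coe]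
  rw [Fin.prod_univ_castSucc, Fin.prod_univ_castSucc]
  simp only [next_isingSiteEquiv_castSucc, next_isingSiteEquiv_last, hσ,
    hexp, Finset.prod_mul_distrib, Fin.val_castSucc, Fin.val_last]
  simp only [hT, ha, hw]
  ring

theorem partitionFunction_eq_zero_iff (J : ℤ → ℝ) (kB τ : ℝ) {ρ : ℤ → ℝ} (hρ : ∀ n, ρ n ≠ 0)
    (l r : ℕ) (H : ℂ) :
    partitionFunction J kB τ l r H = 0 ↔
      (isingMonodromy (Complex.exp (((kB * τ)⁻¹ : ℝ) * H))
        (fun n => Real.exp (-2 * ((kB * τ)⁻¹ * J n))) ρ (-l) (l + r + 1)).trace = 0 := by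
  rw [partitionFunction_eq_mul_trace J kB τ hρ, mul_eq_zero, or_iff_right]
  refine Finset.prod_ne_zero_iff.2 fun j _ => mul_ne_zero (Complex.exp_ne_zero _) ?_
  exact_mod_cast hρ _

theorem isingMonodromy_congr {a a' ρ ρ' : ℤ → ℝ} {b : ℤ} {k : ℕ}
    (h : ∀ n ∈ Finset.Ico b (b + k), a n = a' n ∧ ρ n = ρ' n) (w : ℂ) :
    isingMonodromy w a ρ b k = isingMonodromy w a' ρ' b k := by
  induction k with
  | zero => rfl
  | succ k ih =>
    have h1 := h (b + k) (Finset.mem_Ico.2 ⟨by omega, by omega⟩)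
    rw [isingMonodromy, isingMonodromy, h1.1, h1.2, ih fun n hn => h n ?_]
    rw [Finset.mem_Ico] at hn ⊢
    omega

end PartitionFunction

/-! ### Recurrence of words in an independent sequence -/

section Recurrence

variable {X : Type*} [MeasurableSpace X]

/-- Disjoint blocks of length `L` are independent and each shows the word with the same positive
probability, so the second Borel–Cantelli lemma applies. -/
theorem ae_exists_block_mem (ν : Measure X) [IsProbabilityMeasure ν] {L : ℕ} (hL : 0 < L)
    {O : Fin L → Set X} (hO : ∀ i, MeasurableSet (O i)) (hO0 : ∀ i, ν (O i) ≠ 0) :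
    ∀ᵐ J ∂(Measure.infinitePi fun _ : ℤ => ν),
      ∃ s : ℕ, ∀ i : Fin L, J (L * s + (i : ℕ)) ∈ O i := by
  have hL' : (0 : ℤ) < L := by exact_mod_cast hL
  set t : ℤ → Set X := fun z => O ⟨(z % L).toNat, by
    have h1 := Int.emod_nonneg z hL'.ne'
    have h2 := Int.emod_lt_of_pos z hL'
    omega⟩ with ht
  have htm : ∀ z, MeasurableSet (t z) := fun z => hO _
  set block : ℕ → Finset ℤ := fun s => Finset.Ico ((L : ℤ) * s) (L * s + L) with hblock
  have hti : ∀ (s : ℕ) (i : Fin L), t (L * s + (i : ℕ)) = O i := fun s i => by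
    have : ((L * s + (i : ℕ) : ℤ) % L).toNat = i := by
      rw [Int.mul_add_emod_self_left, Int.emod_eq_of_lt (by omega) (by omega), Int.toNat_natCast]
    simp only [ht, this]
  set E : ℕ → Set (ℤ → X) := fun s => Set.pi (block s) t with hE
  have hEm : ∀ s, MeasurableSet (E s) := fun s =>
    MeasurableSet.pi (block s).countable_toSet fun z _ => htm z
  set μ := Measure.infinitePi fun _ : ℤ => ν with hμ
  have hdisj : Pairwise (Function.onFun Disjoint block) := by
    intro s s' hss
    rw [Function.onFun, Finset.disjoint_left]
    intro z h1 h2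
    rw [Finset.mem_Ico] at h1 h2
    refine hss ?_
    have h3 : (s : ℤ) < s' + 1 := by nlinarith
    have h4 : (s' : ℤ) < s + 1 := by nlinarith
    omega
  have hEμ : ∀ s, μ (E s) = ∏ i, ν (O i) := by
    intro s
    rw [hE, hμ, Measure.infinitePi_pi _ fun z _ => htm z]
    symm
    refine Finset.prod_bij (fun i _ => (L * s + (i : ℕ) : ℤ)) ?_ ?_ ?_ ?_
    · intro i _
      rw [Finset.mem_Ico]
      omega
    · intro i _ j _ hij
      exact Fin.ext (by omega)
    · intro z hz
      rw [Finset.mem_Ico] at hz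
      exact ⟨⟨(z - L * s).toNat, by omega⟩, Finset.mem_univ _, by simp only; omega⟩
    · intro i _
      rw [hti]
  have hindep : ProbabilityTheory.iIndepSet E μ := by
    rw [ProbabilityTheory.iIndepSet_iff_meas_biInter hEm]
    intro S
    have hInter : ⋂ s ∈ S, E s = Set.pi (S.biUnion block : Finset ℤ) t := by
      ext J
      simp only [hE, Set.mem_iInter, Set.mem_pi, Finset.mem_coe, Finset.mem_biUnion]
      exact ⟨fun h z ⟨s, hs, hz⟩ => h s hs z hz, fun h s hs z hz => h z ⟨s, hs, hz⟩⟩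
    rw [hInter, hμ, Measure.infinitePi_pi _ fun z _ => htm z,
      Finset.prod_biUnion (hdisj.set_pairwise _)]
    refine Finset.prod_congr rfl fun s _ => ?_
    rw [hE, Measure.infinitePi_pi _ fun z _ => htm z]
  have hsum : ∑' s, μ (E s) = ∞ := by
    simp only [hEμ]
    exact ENNReal.tsum_const_eq_top_of_ne_zero (Finset.prod_ne_zero_iff.2 fun i _ => hO0 i)
  have hlim := ProbabilityTheory.measure_limsup_eq_one hEm hindep hsum
  have hae : ∀ᵐ J ∂μ, J ∈ limsup E atTop :=
    (prob_compl_eq_zero_iff (MeasurableSet.measurableSet_limsup hEm)).2 hlim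
  filter_upwards [hae] with J hJ
  rw [mem_limsup_iff_frequently_mem] at hJ
  obtain ⟨s, hs⟩ := hJ.exists
  refine ⟨s, fun i => ?_⟩
  rw [← hti s i]
  exact hs _ (by
    rw [Finset.mem_coe, Finset.mem_Ico]
    omega)

/-- Almost every sequence of independent letters contains, at even positions, approximate copies
of all finite words made of its own letters. -/
theorem ae_exists_even_shift_dist_lt {X : Type*} [PseudoMetricSpace X] [SecondCountableTopology X]
    [MeasurableSpace X] [OpensMeasurableSpace X] (ν : Measure X) [IsProbabilityMeasure ν] :
    ∀ᵐ J ∂(Measure.infinitePi fun _ : ℤ => ν), ∀ f : ℤ → X, (∀ n, f n ∈ Set.range J) →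
      ∀ (A : ℕ) (ε : ℝ), 0 < ε →
        ∃ s : ℤ, Even s ∧ ∀ n ∈ Finset.Icc (-A : ℤ) A, dist (J (n + s)) (f n) < ε := by
  have hB := TopologicalSpace.isBasis_countableBasis X
  have hBo : ∀ O : TopologicalSpace.countableBasis X, MeasurableSet (O : Set X) :=
    fun O => (hB.isOpen O.2).measurableSet
  have : Countable (TopologicalSpace.countableBasis X) :=
    (TopologicalSpace.countable_countableBasis X).to_subtype
  have h1 : ∀ᵐ J ∂(Measure.infinitePi fun _ : ℤ => ν),
      -- Almost surely, no letter of `J` lies in a null set of the countable basis; hence words made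
      -- of letters of `J` have neighbourhoods of positive measure.
      ∀ (O : TopologicalSpace.countableBasis X) (n : ℤ), J n ∈ (O : Set X) → ν O ≠ 0 := by
    rw [ae_all_iff]
    intro O
    rw [ae_all_iff]
    intro n
    by_cases hO : ν O = 0
    · have h2 : (Measure.infinitePi fun _ : ℤ => ν) ((fun J : ℤ → X => J n) ⁻¹' O) = 0 := by
        rw [(measurePreserving_eval_infinitePi (fun _ : ℤ => ν) n).measure_preimage
          (hBo O).nullMeasurableSet, hO]
      filter_upwards [measure_eq_zero_iff_ae_notMem.1 h2] with J hJ hJ'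
      exact absurd hJ' hJ
    · exact ae_of_all _ fun _ _ => hO
  have h2 : ∀ᵐ J ∂(Measure.infinitePi fun _ : ℤ => ν),
      ∀ (A : ℕ) (O : Fin (4 * A + 4) → TopologicalSpace.countableBasis X), (∀ i, ν (O i) ≠ 0) →
        ∃ s : ℕ, ∀ i : Fin (4 * A + 4), J ((4 * A + 4 : ℕ) * s + (i : ℕ)) ∈ (O i : Set X) := by
    rw [ae_all_iff]
    intro A
    rw [ae_all_iff]
    intro O
    by_cases hO : ∀ i, ν (O i) ≠ 0
    · filter_upwards [ae_exists_block_mem ν (by omega) (fun i => hBo (O i)) hO] with J hJ _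
      exact hJ
    · exact ae_of_all _ fun _ h => absurd h hO
  filter_upwards [h1, h2] with J hJ1 hJ2 f hf A ε hε
  have hO : ∀ x : X, ∃ O : TopologicalSpace.countableBasis X, x ∈ (O : Set X) ∧
      (O : Set X) ⊆ Metric.ball x ε := fun x => by
    obtain ⟨O, hO, hxO, hOε⟩ := hB.exists_subset_of_mem_open (Metric.mem_ball_self hε)
      Metric.isOpen_ball
    exact ⟨⟨O, hO⟩, hxO, hOε⟩
  choose O hxO hOε using hO
  obtain ⟨s, hs⟩ := hJ2 A (fun i => O (f ((i : ℕ) - (2 * A : ℤ)))) fun i => by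
    obtain ⟨m, hm⟩ := hf ((i : ℕ) - (2 * A : ℤ))
    exact hJ1 _ m (hm ▸ hxO _)
  -- The block length and the offset `2 * A` are both even, so the shift is even. The sites `-A, …,
  -- A` become the positions `A, …, 3 * A` of the block.
  refine ⟨(4 * A + 4 : ℕ) * s + 2 * A, ?_, fun n hn => ?_⟩
  · push_cast
    exact ⟨(2 * A + 2) * s + A, by ring⟩
  · rw [Finset.mem_Icc] at hn
    have h3 := hs ⟨(n + 2 * A).toNat, by omega⟩
    have h4 : (((n + 2 * A).toNat : ℕ) : ℤ) = n + 2 * A := Int.toNat_of_nonneg (by omega)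
    have h5 := hOε _ h3
    rw [h4, add_sub_cancel_right, Metric.mem_ball] at h5
    convert! h5 using 3
    ring

end Recurrence

/-! ### Lower bounds, limits of shifts, and bounded eigenvectors -/

section BoundedBelow

/-- The operator `cmvAct a ρ - z` is bounded below on finitely supported sequences. -/
def CMVBoundedBelow (a ρ : ℤ → ℝ) (z : ℂ) (C : ℝ) : Prop :=
  ∀ (s t : ℤ) (ψ : ℤ → ℂ), (∀ n ∉ Finset.Icc s t, ψ n = 0) →
    ∑ n ∈ Finset.Icc s t, ‖ψ n‖ ^ 2 ≤
      C * ∑ n ∈ Finset.Icc (s - 2) (t + 2), ‖cmvAct a ρ ψ n - z * ψ n‖ ^ 2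

theorem continuous_cmvAct_apply (ψ : ℤ → ℂ) (n : ℤ) :
    Continuous fun x : (ℤ → ℝ) × (ℤ → ℝ) => cmvAct x.1 x.2 ψ n := by
  by_cases hn : Even n
  · simp only [cmvAct_of_even hn]
    fun_prop
  · simp only [cmvAct_of_not_even hn]
    fun_prop

variable {a ρ a' ρ' : ℤ → ℝ} {z : ℂ} {C : ℝ}

theorem sum_Icc_add_right (F : ℤ → ℝ) (s t k : ℤ) :
    ∑ n ∈ Finset.Icc (s + k) (t + k), F n = ∑ n ∈ Finset.Icc s t, F (n + k) := by
  rw [← Finset.map_add_right_Icc, Finset.sum_map]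
  rfl

theorem CMVBoundedBelow.shift (h : CMVBoundedBelow a ρ z C) {k : ℤ} (hk : Even k) :
    CMVBoundedBelow (fun n => a (n + k)) (fun n => ρ (n + k)) z C := by
  intro s t ψ hψ
  have h1 := h (s + k) (t + k) (fun n => ψ (n - k)) fun n hn => hψ _ (by
    rw [Finset.mem_Icc] at hn ⊢
    omega)
  have h2 := cmvAct_shift a ρ (fun n => ψ (n - k)) hk
  simp only [add_sub_cancel_right] at h2
  rw [add_sub_right_comm, add_right_comm, sum_Icc_add_right, sum_Icc_add_right] at h1
  simpa only [add_sub_cancel_right, h2] using h1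

/-- Even shifts keep the constant `C`. For a fixed finitely supported `ψ`, the inequality involves
finitely many coefficients, so their pointwise convergence is enough. -/
theorem CMVBoundedBelow.of_tendsto (h : CMVBoundedBelow a ρ z C) {k : ℕ → ℤ}
    (hk : ∀ m, Even (k m)) (ha : ∀ n, Tendsto (fun m => a (n + k m)) atTop (𝓝 (a' n)))
    (hρ : ∀ n, Tendsto (fun m => ρ (n + k m)) atTop (𝓝 (ρ' n))) :
    CMVBoundedBelow a' ρ' z C := by
  intro s t ψ hψ
  have h1 : ∀ n, Tendsto (fun m => cmvAct (fun n => a (n + k m)) (fun n => ρ (n + k m)) ψ n) atTop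
      (𝓝 (cmvAct a' ρ' ψ n)) := fun n => by
    have h2 := (tendsto_pi_nhds.2 ha).prodMk_nhds (tendsto_pi_nhds.2 hρ)
    exact Tendsto.comp ((continuous_cmvAct_apply ψ n).tendsto (a', ρ')) h2
  have hlim := (tendsto_finsetSum (Finset.Icc (s - 2) (t + 2)) fun n _ =>
    (((h1 n).sub_const (z * ψ n)).norm).pow 2).const_mul C
  exact ge_of_tendsto' hlim fun m => h.shift (hk m) s t ψ hψ

theorem norm_scatter_le (h : ∀ n, a n ^ 2 + ρ n ^ 2 = 1) (e : ℤ) {ψ : ℤ → ℂ} {M : ℝ}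
    (hψ : ∀ n, ‖ψ n‖ ≤ M) (n : ℤ) : ‖scatter e a ρ ψ n‖ ≤ 2 * M := by
  have h1 : ∀ n m, ‖(a n : ℂ) * ψ m‖ ≤ M := fun n m => by
    rw [norm_mul, Complex.norm_real, Real.norm_eq_abs]
    have : |a n| ≤ 1 := abs_le_one_iff_mul_self_le_one.2 (by nlinarith [h n, sq_nonneg (ρ n)])
    exact (mul_le_of_le_one_left (norm_nonneg _) this).trans (hψ m)
  have h2 : ∀ n m, ‖(ρ n : ℂ) * ψ m‖ ≤ M := fun n m => by
    rw [norm_mul, Complex.norm_real, Real.norm_eq_abs]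
    have : |ρ n| ≤ 1 := abs_le_one_iff_mul_self_le_one.2 (by nlinarith [h n, sq_nonneg (a n)])
    exact (mul_le_of_le_one_left (norm_nonneg _) this).trans (hψ m)
  rw [two_mul]
  by_cases hn : Even (n + e)
  · rw [scatter_of_even hn]
    exact (norm_add_le _ _).trans (add_le_add (h1 _ _) (h2 _ _))
  · rw [scatter_of_not_even hn]
    exact (norm_sub_le _ _).trans (add_le_add (h2 _ _) (h1 _ _))

theorem Function.Antiperiodic.exists_norm_le {u : ℤ → ℂ} {N : ℕ} [NeZero N]
    (hu : Function.Antiperiodic u (N : ℤ)) : ∃ M, ∀ n, ‖u n‖ ≤ M := by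
  refine ⟨∑ n : Finset.Ico (0 : ℤ) (0 + N), ‖u n‖, fun n => ?_⟩
  rw [← antiExt_restrict 0 N hu, antiExt_apply, norm_smul, norm_zpow, norm_neg, norm_one,
    one_zpow, one_mul, antiExt_restrict 0 N hu]
  exact Finset.single_le_sum (f := fun n : Finset.Ico (0 : ℤ) (0 + N) => ‖u n‖)
    (fun _ _ => norm_nonneg _) (Finset.mem_univ _)

/-- Truncating `u` to `A` periods gives mass growing linearly in `A`, while the defect lives at the
two ends and stays bounded. -/
theorem not_cmvBoundedBelow_of_antiperiodic (h : ∀ n, a n ^ 2 + ρ n ^ 2 = 1) {u : ℤ → ℂ} {N : ℕ}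
    [NeZero N] (hu : Function.Antiperiodic u (N : ℤ)) (hu0 : u ≠ 0) (heig : cmvAct a ρ u = z • u) :
    ¬ CMVBoundedBelow a ρ z C := by
  intro hC
  obtain ⟨M, hM⟩ := hu.exists_norm_le
  obtain ⟨b, hb⟩ := Function.ne_iff.1 hu0
  have hM0 : 0 ≤ M := (norm_nonneg _).trans (hM b)
  have hN := NeZero.pos N
  -- Each of the two reflection factors at most doubles the supremum norm.
  set B : ℝ := 2 * (2 * M) + ‖z‖ * M with hB
  have hbound : ∀ A : ℕ, (A : ℝ) * ‖u b‖ ^ 2 ≤ |C| * (8 * B ^ 2) := by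
    intro A
    set t : ℤ := b + N * A with ht
    have hbt : b ≤ t := by
      rw [ht]
      exact le_add_of_nonneg_right (by positivity)
    set ψ : ℤ → ℂ := fun n => if n ∈ Finset.Icc b t then u n else 0 with hψ
    have hψ0 : ∀ n ∉ Finset.Icc b t, ψ n = 0 := fun n hn => if_neg hn
    have hψu : ∀ n ∈ Finset.Icc b t, ψ n = u n := fun n hn => if_pos hn
    have hψM : ∀ n, ‖ψ n‖ ≤ M := fun n => by
      by_cases hn : n ∈ Finset.Icc b t
      · rw [hψu n hn]
        exact hM n
      · rwa [hψ0 n hn, norm_zero]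
    have hle := hC b t ψ hψ0
    have hnormN : ∀ j : ℕ, ‖u (b + N * j)‖ = ‖u b‖ := by
      intro j
      induction j with
      | zero => simp
      | succ j ih => rw [Nat.cast_succ, mul_add_one, ← add_assoc, hu, norm_neg, ih]
    have hlow : (A : ℝ) * ‖u b‖ ^ 2 ≤ ∑ n ∈ Finset.Icc b t, ‖ψ n‖ ^ 2 := by
      have hinj : Set.InjOn (fun j : ℕ => b + (N : ℤ) * j) (Finset.range A) := by
        intro i _ j _ hij
        simpa [hN.ne'] using hij
      have hsub : (Finset.range A).image (fun j : ℕ => b + (N : ℤ) * j) ⊆ Finset.Icc b t := by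
        intro n hn
        obtain ⟨j, hj, rfl⟩ := Finset.mem_image.1 hn
        have hj' : (j : ℤ) ≤ A := by exact_mod_cast (Finset.mem_range.1 hj).le
        rw [Finset.mem_Icc]
        exact ⟨le_add_of_nonneg_right (by positivity), by rw [ht]; gcongr⟩
      refine le_trans (le_of_eq ?_)
        (Finset.sum_le_sum_of_subset_of_nonneg hsub fun _ _ _ => by positivity)
      rw [Finset.sum_image hinj]
      have : ∀ j ∈ Finset.range A, ‖ψ (b + N * j)‖ ^ 2 = ‖u b‖ ^ 2 := fun j hj => by
        rw [hψu _ (hsub (Finset.mem_image_of_mem _ hj)), hnormN]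
      rw [Finset.sum_congr rfl this, Finset.sum_const, Finset.card_range, nsmul_eq_mul]
    set E : ℤ → ℝ := fun n => ‖cmvAct a ρ ψ n - z * ψ n‖ ^ 2 with hE
    -- The rows whose band crosses an end of the truncation: at most four at each end.
    set T : Finset ℤ := Finset.Icc (b - 2) (b + 1) ∪ Finset.Icc (t - 1) (t + 2) with hT
    have hTsub : T ⊆ Finset.Icc (b - 2) (t + 2) := by
      intro n hn
      simp only [hT, Finset.mem_union, Finset.mem_Icc] at hn ⊢
      omega
    have hup : ∑ n ∈ Finset.Icc (b - 2) (t + 2), E n ≤ 8 * B ^ 2 := by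
      rw [← Finset.sum_subset hTsub fun n _ hn => ?_]
      · have hcard : T.card ≤ 8 := by
          refine (Finset.card_union_le _ _).trans ?_
          rw [Int.card_Icc, Int.card_Icc]
          omega
        have hEB : ∀ n ∈ T, E n ≤ B ^ 2 := fun n _ => by
          refine pow_le_pow_left₀ (norm_nonneg _) ((norm_sub_le _ _).trans (add_le_add ?_ ?_)) 2
          · rw [cmvAct_apply]
            exact norm_scatter_le h 0 (norm_scatter_le h 1 hψM) n
          · rw [norm_mul]
            exact mul_le_mul_of_nonneg_left (hψM n) (norm_nonneg _)
        refine (Finset.sum_le_card_nsmul T E _ hEB).trans ?_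
        rw [nsmul_eq_mul]
        have : (T.card : ℝ) ≤ 8 := by exact_mod_cast hcard
        gcongr
      · simp only [hT, Finset.mem_union, Finset.mem_Icc, not_or, not_and] at hn
        rename_i hn'
        rw [Finset.mem_Icc] at hn'
        have h1 : cmvAct a ρ ψ n = cmvAct a ρ u n := cmvAct_congr fun k hk =>
          ⟨rfl, rfl, hψu k (by rw [Finset.mem_Icc] at hk ⊢; omega)⟩
        rw [hE]
        simp only
        rw [h1, hψu n (by rw [Finset.mem_Icc]; omega), heig]
        simp
    calc (A : ℝ) * ‖u b‖ ^ 2 ≤ C * ∑ n ∈ Finset.Icc (b - 2) (t + 2), E n := hlow.trans hle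
      _ ≤ |C| * ∑ n ∈ Finset.Icc (b - 2) (t + 2), E n :=
        mul_le_mul_of_nonneg_right (le_abs_self C) (Finset.sum_nonneg fun _ _ => by positivity)
      _ ≤ |C| * (8 * B ^ 2) := by gcongr
  have hub : 0 < ‖u b‖ ^ 2 := pow_pos (norm_pos_iff.2 hb) 2
  obtain ⟨A, hA⟩ := exists_nat_gt (|C| * (8 * B ^ 2) / ‖u b‖ ^ 2)
  rw [div_lt_iff₀ hub] at hA
  exact (hbound A).not_gt hA

end BoundedBelow

/-! ### Lee–Yang zeros and the spectrum -/

section LeeYang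

variable {K kB τ : ℝ}

theorem coe_isingVerblunsky (hkB : 0 < kB) (hτ : 0 < τ) (x : Set.Ioc (0 : ℝ) K) :
    (isingVerblunsky hkB hτ x : ℂ) = (Real.exp (-2 * ((kB * τ)⁻¹ * x)) : ℝ) := by
  have : -2 * ((kB * τ)⁻¹ * (x : ℝ)) = -2 * x / (kB * τ) := by
    rw [div_eq_mul_inv]
    ring
  rw [this]
  rfl

theorem verblunskyRho_pos (α : 𝔻) : 0 < verblunskyRho α := by
  have := α.norm_lt_one
  exact Real.sqrt_pos.2 (by nlinarith [norm_nonneg (α : ℂ)])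

theorem continuous_verblunskyRho_isingVerblunsky (hkB : 0 < kB) (hτ : 0 < τ) :
    Continuous fun x : Set.Ioc (0 : ℝ) K => verblunskyRho (isingVerblunsky hkB hτ x) := by
  simp only [verblunskyRho, coe_isingVerblunsky]
  fun_prop

theorem leeYangZeros_subset_spectrum (hkB : 0 < kB) (hτ : 0 < τ) {J : ℤ → Set.Ioc (0 : ℝ) K}
    (hJ : ∀ f : ℤ → Set.Ioc (0 : ℝ) K, (∀ n, f n ∈ Set.range J) → ∀ (A : ℕ) (ε : ℝ), 0 < ε →
      ∃ s : ℤ, Even s ∧ ∀ n ∈ Finset.Icc (-A : ℤ) A, dist (J (n + s)) (f n) < ε) (l r : ℕ) :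
    leeYangZeros (fun n => (J n : ℝ)) kB τ l r ⊆
      spectrum ℂ (extendedCMV fun n => isingVerblunsky hkB hτ (J n)) := by
  rintro _ ⟨H, rfl, hH⟩
  by_contra hnot
  set A : Set.Ioc (0 : ℝ) K → ℝ := fun x => Real.exp (-2 * ((kB * τ)⁻¹ * x)) with hA
  set R : Set.Ioc (0 : ℝ) K → ℝ := fun x => verblunskyRho (isingVerblunsky hkB hτ x) with hR
  have hAcont : Continuous A := by fun_prop
  have hRcont : Continuous R := continuous_verblunskyRho_isingVerblunsky hkB hτ
  have hAR : ∀ x, A x ^ 2 + R x ^ 2 = 1 := fun x =>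
    sq_add_verblunskyRho_sq (coe_isingVerblunsky hkB hτ x)
  have hRpos : ∀ x, 0 < R x := fun x => verblunskyRho_pos _
  set w : ℂ := Complex.exp (((kB * τ)⁻¹ : ℝ) * H) with hw
  have hw0 : w ≠ 0 := Complex.exp_ne_zero _
  have hwz : Complex.exp (2 * H / (kB * τ)) = w ^ 2 := by
    rw [hw, ← Complex.exp_nat_mul]
    congr 1
    push_cast
    rw [div_eq_mul_inv]
    ring
  rw [hwz] at hnot
  set p := l + r + 1 with hp
  -- The periodized couplings. Their letters all occur in `J`, so `hJ` finds approximate copies of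
  -- them in `J` itself.
  set f : ℤ → Set.Ioc (0 : ℝ) K := fun n => J (windowRep (-l) p n) with hf
  have hfp : ∀ n, f (n + p) = f n := fun n => by simp only [hf, windowRep_add]
  have hap : Function.Periodic (fun n => A (f n)) (p : ℤ) := fun n => by simp only [hfp]
  have hρp : Function.Periodic (fun n => R (f n)) (p : ℤ) := fun n => by simp only [hfp]
  have hfJ : ∀ n ∈ Finset.Ico (-l : ℤ) (-l + p), f n = J n := fun n hn => by
    simp only [hf, windowRep_of_mem hn]
  have htr := (partitionFunction_eq_zero_iff (fun n => (J n : ℝ)) kB τ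
    (ρ := fun n => R (J n)) (fun n => (hRpos _).ne') l r H).1 hH
  rw [isingMonodromy_congr (a' := fun n => A (f n)) (ρ' := fun n => R (f n)) fun n hn => by
    simp only [hfJ n hn, hA, and_self]] at htr
  obtain ⟨u, huN, hu0, heig⟩ := exists_antiperiodic_of_trace_eq_zero hw0 (fun n => hAR (f n))
    (fun n => hRpos (f n)) hap hρp htr
  obtain ⟨C, hC⟩ := exists_sum_le_of_notMem_spectrum
    (fun n => coe_isingVerblunsky hkB hτ (J n)) hnot
  have hC' : CMVBoundedBelow (fun n => A (J n)) (fun n => R (J n)) (w ^ 2) C := hC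
  choose k hk hkJ using fun m : ℕ => hJ f (fun n => ⟨_, rfl⟩) m (1 / (m + 1)) (by positivity)
  have hlim : ∀ n, Tendsto (fun m => J (n + k m)) atTop (𝓝 (f n)) := by
    intro n
    rw [tendsto_iff_dist_tendsto_zero]
    refine squeeze_zero' (Eventually.of_forall fun _ => dist_nonneg) ?_
      tendsto_one_div_add_atTop_nhds_zero_nat
    filter_upwards [eventually_ge_atTop n.natAbs] with m hm
    exact (hkJ m n (Finset.mem_Icc.2 ⟨by omega, by omega⟩)).le
  exact not_cmvBoundedBelow_of_antiperiodic (fun n => hAR (f n)) huN hu0 heig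
    (hC'.of_tendsto hk (fun n => (hAcont.tendsto _).comp (hlim n))
      fun n => (hRcont.tendsto _).comp (hlim n))

theorem exists_mem_leeYangZeros_near (hkB : 0 < kB) (hτ : 0 < τ) (J : ℤ → Set.Ioc (0 : ℝ) K)
    {z : ℂ} (hz : z ∈ spectrum ℂ (extendedCMV fun n => isingVerblunsky hkB hτ (J n)))
    {ε : ℝ} (hε : 0 < ε) :
    ∃ M : ℕ, ∀ l r : ℕ, M ≤ l → M ≤ r →
      ∃ h ∈ leeYangZeros (fun n => (J n : ℝ)) kB τ l r, dist z h < ε := by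
  set A : Set.Ioc (0 : ℝ) K → ℝ := fun x => Real.exp (-2 * ((kB * τ)⁻¹ * x)) with hA
  set R : Set.Ioc (0 : ℝ) K → ℝ := fun x => verblunskyRho (isingVerblunsky hkB hτ x) with hR
  have hAR : ∀ x, A x ^ 2 + R x ^ 2 = 1 := fun x =>
    sq_add_verblunskyRho_sq (coe_isingVerblunsky hkB hτ x)
  have hRpos : ∀ x, 0 < R x := fun x => verblunskyRho_pos _
  obtain ⟨s, t, ψ, hψ, hlt⟩ := exists_sum_lt_of_mem_spectrum
    (fun n => coe_isingVerblunsky hkB hτ (J n)) hz hε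
  -- The image of `ψ` reaches two sites beyond its support and its rows read two further sites.
  -- Within this margin the periodized couplings equal `J`.
  refine ⟨s.natAbs + t.natAbs + 4, fun l r hl hr => ?_⟩
  set p := l + r + 1 with hp
  set f : ℤ → Set.Ioc (0 : ℝ) K := fun n => J (windowRep (-l) p n) with hf
  have hfp : ∀ n, f (n + p) = f n := fun n => by simp only [hf, windowRep_add]
  have hap : Function.Periodic (fun n => A (f n)) (p : ℤ) := fun n => by simp only [hfp]
  have hρp : Function.Periodic (fun n => R (f n)) (p : ℤ) := fun n => by simp only [hfp]
  have hfJ : ∀ n ∈ Finset.Ico (-l : ℤ) (-l + p), f n = J n := fun n hn => by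
    simp only [hf, windowRep_of_mem hn]
  have hNe : NeZero (2 * p) := ⟨by omega⟩
  obtain ⟨y, φ, hφN, hφ0, heig, hy⟩ := exists_antiperiodic_eigenvector (N := 2 * p)
    (a := fun n => A (f n)) (ρ := fun n => R (f n)) (b := -l) (s := s) (t := t) (ψ := ψ) (z := z)
    (fun n => hAR (f n)) (even_two_mul p) hap.two_mul_nat hρp.two_mul_nat (by omega)
    (by push_cast; omega) hψ hε (by
      refine lt_of_eq_of_lt (Finset.sum_congr rfl fun n hn => ?_) hlt
      rw [Finset.mem_Icc] at hn
      rw [cmvAct_congr fun k hk => ?_]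
      rw [Finset.mem_Icc] at hk
      have hk' := hfJ k (Finset.mem_Ico.2 ⟨by omega, by push_cast [hp]; omega⟩)
      exact ⟨by simp only [hk', hA], by simp only [hk', hR], rfl⟩)
  have hy1 := norm_eq_one_of_cmvAct_eq_smul (fun n => hAR (f n)) (even_two_mul p)
    hap.two_mul_nat hρp.two_mul_nat hφN hφ0 heig
  have hy0 : y ≠ 0 := norm_ne_zero_iff.1 (by rw [hy1]; exact one_ne_zero)
  have hkτ : ((kB : ℂ) * τ) ≠ 0 := by exact_mod_cast (mul_pos hkB hτ).ne'
  -- A field with `w ^ 2 = y`, where `y` is the eigenvalue found above.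
  set H : ℂ := kB * τ * (Complex.log y / 2) with hH
  set w : ℂ := Complex.exp (((kB * τ)⁻¹ : ℝ) * H) with hw
  have hwH : ((kB * τ)⁻¹ : ℝ) * H = Complex.log y / 2 := by
    rw [hH]
    push_cast
    rw [inv_mul_cancel_left₀ hkτ]
  have hwy : w ^ 2 = y := by
    rw [hw, hwH, ← Complex.exp_nat_mul, Nat.cast_ofNat, mul_div_cancel₀ _ two_ne_zero,
      Complex.exp_log hy0]
  refine ⟨y, ⟨H, ?_, ?_⟩, by rwa [dist_comm, dist_eq_norm]⟩
  · have : 2 * H / (kB * τ) = Complex.log y := by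
      rw [hH, div_eq_iff hkτ]
      ring
    rw [this, Complex.exp_log hy0]
  · rw [partitionFunction_eq_zero_iff (fun n => (J n : ℝ)) kB τ
      (ρ := fun n => R (J n)) (fun n => (hRpos _).ne') l r H,
      isingMonodromy_congr (a' := fun n => A (f n)) (ρ' := fun n => R (f n)) fun n hn => by
        simp only [hfJ n hn, hA, and_self]]
    exact trace_eq_zero_of_antiperiodic (Complex.exp_ne_zero _) (fun n => hAR (f n))
      (fun n => hRpos (f n)) hap hρp _ hφN hφ0 (by rw [heig, ← hwy])

/-- Only the distance from `σ` to `S k` matters. A finite `δ / 2`-net of `σ` makes the pointwise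
approximation uniform. -/
theorem tendsto_hausdorffEDist_of_subset {X : Type*} [PseudoMetricSpace X] {S : ℕ → Set X}
    {σ : Set X} (hσ : IsCompact σ) (hS : ∀ k, S k ⊆ σ)
    (hnear : ∀ z ∈ σ, ∀ ε > 0, ∀ᶠ k in atTop, ∃ h ∈ S k, dist z h < ε) :
    Tendsto (fun k => Metric.hausdorffEDist (S k) σ) atTop (𝓝 0) := by
  rw [ENNReal.tendsto_nhds_zero]
  intro ε hε
  obtain ⟨δ, -, hδ0, hδ⟩ := ENNReal.lt_iff_exists_real_btwn.1 hε
  have hδ' : 0 < δ := ENNReal.ofReal_pos.1 hδ0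
  obtain ⟨t, htσ, htf, hcov⟩ := hσ.finite_cover_balls (half_pos hδ')
  filter_upwards [(eventually_all_finite htf).2 fun z hz =>
    hnear z (htσ hz) (δ / 2) (half_pos hδ')] with k hk
  refine Metric.hausdorffEDist_le_of_mem_edist (fun x hx => ⟨x, hS k hx, by simp⟩) fun x hx => ?_
  obtain ⟨z, hz, hxz⟩ := Set.mem_iUnion₂.1 (hcov hx)
  obtain ⟨h, hh, hzh⟩ := hk z hz
  refine ⟨h, hh, ?_⟩
  rw [edist_dist]
  refine (ENNReal.ofReal_le_ofReal ?_).trans hδ.le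
  have := dist_triangle x z h
  rw [Metric.mem_ball] at hxz
  linarith

end LeeYang

end

theorem theorem4p2 {K : ℝ} {kB : ℝ} (hkB : 0 < kB)
    (ν : Measure (Set.Ioc (0 : ℝ) K)) [IsProbabilityMeasure ν] :
    ∀ᵐ J : ℤ → Set.Ioc (0 : ℝ) K ∂(Measure.infinitePi fun _ : ℤ => ν),
      ∀ (τ : ℝ) (hτ : 0 < τ),
        spectrum ℂ (extendedCMV fun n => isingVerblunsky hkB hτ (J n)) ⊆ Metric.sphere 0 1 ∧
        (∀ l r : ℕ, leeYangZeros (fun n => (J n : ℝ)) kB τ l r ⊆ Metric.sphere 0 1) ∧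
        ∀ Nl Nr : ℕ → ℕ, Tendsto Nl atTop atTop → Tendsto Nr atTop atTop →
          Tendsto
            (fun k => Metric.hausdorffEDist
              (leeYangZeros (fun n => (J n : ℝ)) kB τ (Nl k) (Nr k))
              (spectrum ℂ (extendedCMV fun n => isingVerblunsky hkB hτ (J n))))
            atTop (𝓝 0) := by
  -- The exceptional set concerns the couplings alone, so it serves all `τ` at once.
  filter_upwards [ae_exists_even_shift_dist_lt ν] with J hJ τ hτ
  have hcircle := spectrum.subset_circle_of_unitary (𝕜 := ℂ)
    (extendedCMV_mem_unitary fun n => coe_isingVerblunsky hkB hτ (J n))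
  have hsub := leeYangZeros_subset_spectrum hkB hτ hJ
  refine ⟨hcircle, fun l r => (hsub l r).trans hcircle, fun Nl Nr hNl hNr => ?_⟩
  refine tendsto_hausdorffEDist_of_subset (spectrum.isCompact _) (fun k => hsub _ _)
    fun z hz ε hε => ?_
  obtain ⟨M, hM⟩ := exists_mem_leeYangZeros_near hkB hτ J hz hε
  filter_upwards [hNl.eventually_ge_atTop M, hNr.eventually_ge_atTop M] with k hl hr
  exact hM _ _ hl hr
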